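/- Let $\theta,\rho$ be real numbers with $|\theta|<1$ and $|\rho|<1$, and let $(V_n)_{n\ge 1}$ be independent and identically distributed real random variables with mean zero, variance $\sigma^2>0$ and a finite moment of order $4$. Let $X_0$ and $\varepsilon_0$ be arbitrary real random variables on the same probability space, and define $(X_n)$ and $(\varepsilon_n)$, for all $n\ge 1$, by $$X_n=\theta X_{n-1}+\varepsilon_n,\qquad \varepsilon_n=\rho\,\varepsilon_{n-1}+V_n .$$ For $n\ge 1$, let $$\widehat\theta_n=\frac{\sum_{k=1}^n X_kX_{k-1}}{\sum_{k=1}^n X_{k-1}^2},$$ let $\widehat\varepsilon_0=X_0$ and $\widehat\varepsilon_k=X_k-\widehat\theta_nX_{k-1}$ for $1\le k\le n$, and let $$\widehat D_n=\frac{\sum_{k=1}^n(\widehat\varepsilon_k-\widehat\varepsilon_{k-1})^2}{\sum_{k=0}^n\widehat\varepsilon_k^{\,2}}$$ be the Durbin–Watson statistic (quotients with zero denominator are read as $0$). Assume that $\theta\neq 0$ and $\theta\neq-\rho$. (i) Under the null hypothesis $\mathcal H_0:\rho=0$, as $n\to\infty$, $$\frac{n}{4\widehat\theta_n^{\,2}}\bigl(\widehat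 D_n-2\bigr)^2\longrightarrow \chi^2 \quad\text{in distribution},$$ where $\chi^2$ has the chi-square distribution with one degree of freedom. (ii) Under the alternative hypothesis $\mathcal H_1:\rho\neq 0$, $$\lim_{n\to\infty}\frac{n}{4\widehat\theta_n^{\,2}}\bigl(\widehat D_n-2\bigr)^2=+\infty\quad\text{almost surely}.$$ -/

import Mathlib

open MeasureTheory ProbabilityTheory Filter Topology

/-- The least squares estimator of the autoregressive parameter, computed from `x 0, …, x n`:
`(∑_{k=1}^n x_k x_{k-1}) / (∑_{k=1}^n x_{k-1}^2)`. -/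
noncomputable def thetaHat (x : ℕ → ℝ) (n : ℕ) : ℝ :=
  (∑ k ∈ Finset.range n, x (k + 1) * x k) / ∑ k ∈ Finset.range n, x k ^ 2

/-- The least squares residuals at step `n`: the `k`-th one is `x_k - θ̂_n x_{k-1}` for `k ≥ 1`,
and the initial one is `x_0`. -/
noncomputable def lsResidual (x : ℕ → ℝ) (n : ℕ) : ℕ → ℝ
  | 0 => x 0
  | k + 1 => x (k + 1) - thetaHat x n * x k

/-- The Durbin-Watson statistic
`(∑_{k=1}^n (ε̂_k - ε̂_{k-1})^2) / (∑_{k=0}^n ε̂_k^2)`, with the residuals `ε̂_k` at step `n`. -/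
noncomputable def durbinWatson (x : ℕ → ℝ) (n : ℕ) : ℝ :=
  (∑ k ∈ Finset.range n, (lsResidual x n (k + 1) - lsResidual x n k) ^ 2) /
    ∑ k ∈ Finset.range (n + 1), lsResidual x n k ^ 2

/-- The test statistic `n (D̂_n - 2)^2 / (4 θ̂_n^2)`. -/
noncomputable def dwTestStatistic (x : ℕ → ℝ) (n : ℕ) : ℝ :=
  n / (4 * thetaHat x n ^ 2) * (durbinWatson x n - 2) ^ 2

/-- The chi-square distribution with one degree of freedom: the law of the square of a standard
normal random variable. -/
noncomputable def chiSquareOne : Measure ℝ :=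
  (gaussianReal 0 1).map (fun z : ℝ => z ^ 2)

instance instIsProbabilityMeasureChiSquareOne : IsProbabilityMeasure chiSquareOne :=
  Measure.isProbabilityMeasure_map (by fun_prop)

/-! The argument is a pathwise law of large numbers followed by a martingale central limit theorem.

Along a fixed path, all that matters of the noise is that its squares average to `σ ^ 2`, that its
products at each positive lag average to zero, and that it is `o(n ^ (1 / 4))` (`IsNoisePath`). These
hold almost surely (`ae_isNoisePath`): the lag products are independent along residue classes, so
the strong law applies to each class, and the fourth moment gives the growth bound. Asymptotic
uncorrelatedness with the later noise passes through an autoregression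
(`LagUncorrelated.autoregression`), whatever the initial value, and the Yule-Walker equations then
give the limits of the quadratic statistics of `X`. By least squares orthogonality the numerator of
`D̂_n - 2` is, up to boundary terms, `2 θ̂_n` times `∑ X_k X_{k-2} - θ̂_n ∑ X_{k-1} X_{k-2}`
(`durbinWatson_sub_two`). Hence `θ̂_n → θ* = (θ + ρ) / (1 + θ ρ)` and `D̂_n - 2 → -2 θ ρ θ*`; when
`θ`, `ρ` and `θ*` do not vanish the test statistic grows like `n θ² ρ²`.

When `ρ = 0`, let `Y` be the autoregression started at zero. The signed root of the test
statistic is pathwise equivalent to a random factor tending to `σ⁻²`, times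
`n ^ (-1 / 2) ∑ V_k (Y_{k-2} - θ Y_{k-1})`, up to a vanishing multiple of
`n ^ (-1 / 2) ∑ V_k Y_{k-1}` (`IsNoisePath.tendsto_dwRoot_sub`). Both sums are martingale transforms
of an i.i.d. noise, for which a central limit theorem is proved by characteristic functions
(`tendstoInDistribution_martingaleTransform`). The weights of the first one have mean square
`(1 - θ²) Var Y = σ²`, so it converges to a Gaussian law with variance `σ⁴`, and Slutsky's theorem
concludes. -/

/-! ### Averages and stability of autoregressions along a path -/

/-- The average `(f 0 + ⋯ + f (n - 1)) / n`. -/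
noncomputable def avg (f : ℕ → ℝ) (n : ℕ) : ℝ := (∑ k ∈ Finset.range n, f k) / n

theorem avg_add (f g : ℕ → ℝ) (n : ℕ) : avg (fun k => f k + g k) n = avg f n + avg g n := by
  simp only [avg, Finset.sum_add_distrib, add_div]

theorem avg_const_mul (c : ℝ) (f : ℕ → ℝ) (n : ℕ) : avg (fun k => c * f k) n = c * avg f n := by
  simp only [avg, ← Finset.mul_sum, mul_div_assoc]

theorem tendsto_const_div_natCast (c : ℝ) : Tendsto (fun n : ℕ => c / (n : ℝ)) atTop (𝓝 0) :=
  tendsto_const_div_atTop_nhds_zero_nat c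

theorem tendsto_natCast_succ_div : Tendsto (fun n : ℕ => ((n + 1 : ℕ) : ℝ) / n) atTop (𝓝 1) := by
  have h : Tendsto (fun n : ℕ => 1 + 1 / (n : ℝ)) atTop (𝓝 (1 + 0)) :=
    tendsto_const_nhds.add (tendsto_const_div_natCast 1)
  rw [add_zero] at h
  refine h.congr' ?_
  filter_upwards [eventually_gt_atTop 0] with n hn
  have : (n : ℝ) ≠ 0 := by positivity
  push_cast
  field_simp

/-- Dropping the first term does not change the limit of the averages. -/
theorem tendsto_avg_succ {f : ℕ → ℝ} {l : ℝ} (h : Tendsto (avg f) atTop (𝓝 l)) :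
    Tendsto (avg fun k => f (k + 1)) atTop (𝓝 l) := by
  have h1 := (h.comp (tendsto_add_atTop_nat 1)).mul tendsto_natCast_succ_div
  have h2 := h1.sub (tendsto_const_div_natCast (f 0))
  simp only [mul_one, sub_zero] at h2
  refine h2.congr' ?_
  filter_upwards [eventually_gt_atTop 0] with n hn
  have : (n : ℝ) ≠ 0 := by positivity
  have h3 : ((n + 1 : ℕ) : ℝ) ≠ 0 := by positivity
  simp only [avg, Function.comp, Finset.sum_range_succ' f n]
  field_simp
  ring

/-- If the averages of `f` converge, then `f n = o(n)`. -/
theorem tendsto_div_of_tendsto_avg {f : ℕ → ℝ} {l : ℝ} (h : Tendsto (avg f) atTop (𝓝 l)) :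
    Tendsto (fun n : ℕ => f n / n) atTop (𝓝 0) := by
  have h1 := ((h.comp (tendsto_add_atTop_nat 1)).mul tendsto_natCast_succ_div).sub h
  simp only [mul_one, sub_self] at h1
  refine h1.congr' ?_
  filter_upwards [eventually_gt_atTop 0] with n hn
  have : (n : ℝ) ≠ 0 := by positivity
  have h3 : ((n + 1 : ℕ) : ℝ) ≠ 0 := by positivity
  simp only [avg, Function.comp, Finset.sum_range_succ f n]
  field_simp
  ring

theorem avg_succ_sub {f : ℕ → ℝ} (n : ℕ) :
    avg (fun k => f (k + 1)) n = avg f n + (f n / n - f 0 / n) := by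
  have h := Finset.sum_range_succ' f n
  rw [Finset.sum_range_succ] at h
  simp only [avg, ← sub_div, ← add_div]
  congr 1
  linarith

/-- A nonnegative sequence which contracts up to a vanishing perturbation tends to zero. -/
theorem tendsto_zero_of_le_mul_add {y δ : ℕ → ℝ} {a : ℝ} (ha : 0 ≤ a) (ha1 : a < 1)
    (hy : ∀ n, 0 ≤ y n) (hδ : Tendsto δ atTop (𝓝 0)) (h : ∀ n, y (n + 1) ≤ a * y n + δ n) :
    Tendsto y atTop (𝓝 0) := by
  rw [Metric.tendsto_atTop]
  intro r hr
  have h1 : ∀ᶠ n in atTop, δ n < (1 - a) * (r / 2) :=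
    hδ.eventually_lt_const (by have := sub_pos.2 ha1; positivity)
  obtain ⟨N, hN⟩ := eventually_atTop.1 h1
  have h2 : ∀ m, y (N + m) ≤ a ^ m * y N + r / 2 := by
    intro m
    induction m with
    | zero => simp; linarith
    | succ m ih =>
      have h3 := h (N + m)
      have h4 := hN (N + m) (by omega)
      have h5 := mul_le_mul_of_nonneg_left ih ha
      rw [← add_assoc, pow_succ]
      nlinarith
  have h3 : Tendsto (fun m : ℕ => a ^ m * y N) atTop (𝓝 (0 * y N)) :=
    (tendsto_pow_atTop_nhds_zero_of_lt_one ha ha1).mul_const _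
  rw [zero_mul] at h3
  obtain ⟨M, hM⟩ := eventually_atTop.1 (h3.eventually_lt_const (half_pos hr))
  refine ⟨N + M, fun n hn => ?_⟩
  obtain ⟨m, rfl⟩ := Nat.exists_eq_add_of_le (show N ≤ n by omega)
  have h4 := hM m (by omega)
  have h5 := h2 m
  rw [Real.dist_eq, sub_zero, abs_of_nonneg (hy _)]
  linarith

/-- The partial sums of squares of `x` grow at most linearly. -/
def SumSqLinear (x : ℕ → ℝ) : Prop :=
  ∃ C : ℝ, 0 ≤ C ∧ ∀ n : ℕ, ∑ k ∈ Finset.range n, x k ^ 2 ≤ C * (n + 1)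

theorem sumSqLinear_of_succ {x : ℕ → ℝ} {C : ℝ} (hC : 0 ≤ C)
    (h : ∀ n : ℕ, ∑ k ∈ Finset.range n, x (k + 1) ^ 2 ≤ C * (n + 1)) : SumSqLinear x := by
  refine ⟨C + x 0 ^ 2, by positivity, fun n => ?_⟩
  have h1 : ∑ k ∈ Finset.range n, x k ^ 2 ≤ ∑ k ∈ Finset.range (n + 1), x k ^ 2 :=
    Finset.sum_le_sum_of_subset_of_nonneg (Finset.range_mono (Nat.le_succ n))
      fun _ _ _ => sq_nonneg _
  rw [Finset.sum_range_succ'] at h1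
  have := h n
  nlinarith [mul_nonneg (sq_nonneg (x 0)) (Nat.cast_nonneg (α := ℝ) n)]

theorem sumSqLinear_of_tendsto_avg {x : ℕ → ℝ} {l : ℝ}
    (h : Tendsto (avg fun k => x (k + 1) ^ 2) atTop (𝓝 l)) : SumSqLinear x := by
  obtain ⟨C, hC⟩ := h.bddAbove_range
  refine sumSqLinear_of_succ (C := max C 0) (le_max_right _ _) fun n => ?_
  rcases Nat.eq_zero_or_pos n with rfl | hn
  · simp
  have h1 : avg (fun k => x (k + 1) ^ 2) n ≤ C := hC ⟨n, rfl⟩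
  have h2 : (0 : ℝ) < n := by positivity
  rw [avg, div_le_iff₀ h2] at h1
  nlinarith [le_max_left C 0, le_max_right C 0]

theorem SumSqLinear.shift {x : ℕ → ℝ} (h : SumSqLinear x) (j : ℕ) :
    SumSqLinear fun k => x (k + j) := by
  obtain ⟨C, hC0, hC⟩ := h
  refine ⟨C * (j + 1), by positivity, fun n => ?_⟩
  have h1 : ∑ k ∈ Finset.range n, x (k + j) ^ 2 ≤ ∑ k ∈ Finset.range (n + j), x k ^ 2 := by
    rw [add_comm n j, Finset.sum_range_add]
    simp only [add_comm j]
    exact le_add_of_nonneg_left (Finset.sum_nonneg fun _ _ => sq_nonneg _)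
  refine h1.trans ((hC _).trans ?_)
  push_cast
  rw [mul_assoc]
  refine mul_le_mul_of_nonneg_left ?_ hC0
  nlinarith [mul_nonneg (Nat.cast_nonneg (α := ℝ) n) (Nat.cast_nonneg (α := ℝ) j)]

/-- Stability of the autoregression: the quadratic mean of the solution is controlled by the one
of the innovations. -/
theorem SumSqLinear.autoregression {x e : ℕ → ℝ} {a : ℝ} (ha : |a| < 1)
    (hx : ∀ n, x (n + 1) = a * x n + e (n + 1)) (he : SumSqLinear e) : SumSqLinear x := by
  obtain ⟨C, hC0, hC⟩ := he.shift 1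
  have hq : 0 < 1 - |a| := sub_pos.2 ha
  refine ⟨x 0 ^ 2 / (1 - |a|) + C / (1 - |a|) ^ 2, by positivity, fun n => ?_⟩
  -- convexity of the square, with weights `|a|` and `1 - |a|`
  have h1 : ∀ k, x (k + 1) ^ 2 ≤ |a| * x k ^ 2 + e (k + 1) ^ 2 / (1 - |a|) := by
    intro k
    have h2 : |a| ^ 2 = a ^ 2 := sq_abs a
    have h3 : (1 - |a|) * (a * x k + e (k + 1)) ^ 2
        ≤ (1 - |a|) * (|a| * x k ^ 2) + e (k + 1) ^ 2 := by
      rcases abs_cases a with ⟨h, -⟩ | ⟨h, -⟩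
      · have : 0 ≤ |a| * ((1 - |a|) * x k - e (k + 1)) ^ 2 := by positivity
        rw [h] at this ⊢
        linarith
      · have : 0 ≤ |a| * ((1 - |a|) * x k + e (k + 1)) ^ 2 := by positivity
        rw [h] at this ⊢
        linarith
    rw [hx k, ← sub_le_iff_le_add', le_div_iff₀ hq]
    linarith
  set T : ℝ := ∑ k ∈ Finset.range n, x k ^ 2
  have h2 : T ≤ x 0 ^ 2 + |a| * T + (∑ k ∈ Finset.range n, e (k + 1) ^ 2) / (1 - |a|) := by
    have h3 : T ≤ ∑ k ∈ Finset.range (n + 1), x k ^ 2 :=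
      Finset.sum_le_sum_of_subset_of_nonneg (Finset.range_mono (Nat.le_succ n))
        fun _ _ _ => sq_nonneg _
    rw [Finset.sum_range_succ'] at h3
    have h4 := Finset.sum_le_sum fun k (_ : k ∈ Finset.range n) => h1 k
    rw [Finset.sum_add_distrib, ← Finset.mul_sum, ← Finset.sum_div] at h4
    linarith
  have h5 := hC n
  have h6 : (1 - |a|) * T ≤ x 0 ^ 2 * (n + 1) + C * (n + 1) / (1 - |a|) := by
    have h7 := div_le_div_of_nonneg_right h5 hq.le
    nlinarith [mul_nonneg (sq_nonneg (x 0)) (Nat.cast_nonneg (α := ℝ) n)]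
  have h8 : T ≤ (x 0 ^ 2 * (n + 1) + C * (n + 1) / (1 - |a|)) / (1 - |a|) := by
    rw [le_div_iff₀ hq]; linarith
  refine h8.trans (le_of_eq ?_)
  field_simp

/-- The averages of products of two sequences, at all positive lags, tend to zero. -/
def LagUncorrelated (x u : ℕ → ℝ) : Prop :=
  ∀ j, Tendsto (avg fun k => x k * u (k + 1 + j)) atTop (𝓝 0)

/-- If the innovations `e` of an autoregression are asymptotically uncorrelated with the later
values of `u`, so is its solution. The lag `j` correlation is bounded by `|a|` times the one at
lag `j + 1`, up to a vanishing term; all of them are bounded, and one iterates. -/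
theorem LagUncorrelated.autoregression {x e u : ℕ → ℝ} {a : ℝ} (ha : |a| < 1)
    (hx : ∀ n, x (n + 1) = a * x n + e (n + 1)) (hx2 : SumSqLinear x) (hu : SumSqLinear u)
    (he : LagUncorrelated (fun k => e (k + 1)) fun k => u (k + 1)) : LagUncorrelated x u := by
  obtain ⟨C, hC0, hC⟩ := hx2
  obtain ⟨D, hD0, hD⟩ := hu
  set B := C + D with hB
  have hB0 : 0 ≤ B := add_nonneg hC0 hD0
  -- the lag sums after `m` steps of the iteration, uniformly in the lag
  have key : ∀ m j, ∀ r > 0, ∀ᶠ n : ℕ in atTop,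
      |∑ k ∈ Finset.range n, x k * u (k + 1 + j)| ≤ (|a| ^ m * B + r) * n := by
    intro m
    induction m with
    | zero =>
      intro j r hr
      have h1 : ∀ᶠ n : ℕ in atTop, C + D * (j + 2) ≤ r * n :=
        (tendsto_natCast_atTop_atTop.const_mul_atTop hr).eventually_ge_atTop _
      filter_upwards [h1] with n hn
      have h2 : ∑ k ∈ Finset.range n, u (k + 1 + j) ^ 2
          ≤ ∑ k ∈ Finset.range (n + (1 + j)), u k ^ 2 := by
        have h3 : ∀ k ∈ Finset.range n, u (k + 1 + j) ^ 2 = u (1 + j + k) ^ 2 := fun k _ => by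
          rw [show k + 1 + j = 1 + j + k by ring]
        rw [add_comm n, Finset.sum_range_add, Finset.sum_congr rfl h3]
        exact le_add_of_nonneg_left (Finset.sum_nonneg fun _ _ => sq_nonneg _)
      have h3 := hC n
      have h4 := hD (n + (1 + j))
      push_cast at h4
      have h5 : |∑ k ∈ Finset.range n, x k * u (k + 1 + j)|
          ≤ ∑ k ∈ Finset.range n, x k ^ 2 + ∑ k ∈ Finset.range n, u (k + 1 + j) ^ 2 := by
        rw [← Finset.sum_add_distrib]
        refine (Finset.abs_sum_le_sum_abs _ _).trans (Finset.sum_le_sum fun k _ => ?_)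
        rw [abs_le]
        constructor <;> nlinarith [sq_nonneg (x k + u (k + 1 + j)), sq_nonneg (x k - u (k + 1 + j))]
      simp only [pow_zero, one_mul]
      nlinarith
    | succ m ih =>
      intro j r hr
      have h1 := ih (j + 1) (r / 4) (by positivity)
      have h2 : ∀ᶠ n : ℕ in atTop, |avg (fun k => e (k + 1) * u (k + 1 + j + 1)) n| < r / 4 := by
        have := (he j).abs
        rw [abs_zero] at this
        exact this.eventually_lt_const (by positivity)
      have h3 : ∀ᶠ n : ℕ in atTop, |x 0 * u (0 + 1 + j)| ≤ r / 4 * n :=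
        (tendsto_natCast_atTop_atTop.const_mul_atTop (by positivity)).eventually_ge_atTop _
      have h4 : ∀ᶠ n : ℕ in atTop, |∑ k ∈ Finset.range (n + 1), x k * u (k + 1 + j)|
          ≤ (|a| ^ (m + 1) * B + r) * (n + 1 : ℕ) := by
        filter_upwards [h1, h2, h3, eventually_gt_atTop 0] with n h1 h2 h3 hn
        have hn : (0 : ℝ) < n := by positivity
        rw [avg, abs_div, Nat.abs_cast, div_lt_iff₀ hn] at h2
        have h5 : ∑ k ∈ Finset.range (n + 1), x k * u (k + 1 + j)
            = a * ∑ k ∈ Finset.range n, x k * u (k + 1 + (j + 1))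
              + ∑ k ∈ Finset.range n, e (k + 1) * u (k + 1 + j + 1) + x 0 * u (0 + 1 + j) := by
          rw [Finset.sum_range_succ', Finset.mul_sum, ← Finset.sum_add_distrib]
          congr 1
          refine Finset.sum_congr rfl fun k _ => ?_
          rw [hx k, show k + 1 + 1 + j = k + 1 + j + 1 by ring, ← add_assoc (k + 1)]
          ring
        have h6 := mul_le_mul_of_nonneg_left h1 (abs_nonneg a)
        have h7 : |a| * (r / 4) * n ≤ r / 4 * n := by
          have : |a| * (r / 4 * n) ≤ 1 * (r / 4 * n) := by gcongr
          linarith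
        have h8 : 0 ≤ |a| ^ (m + 1) * B := by positivity
        rw [h5]
        refine (abs_add_le _ _).trans ((add_le_add_left (abs_add_le _ _) _).trans ?_)
        rw [abs_mul]
        push_cast
        rw [pow_succ] at h8 ⊢
        nlinarith
      obtain ⟨N, hN⟩ := eventually_atTop.1 h4
      filter_upwards [eventually_ge_atTop (N + 1)] with n hn
      obtain ⟨n, rfl⟩ : ∃ m, n = m + 1 := ⟨n - 1, by omega⟩
      exact hN n (by omega)
  intro j
  rw [Metric.tendsto_atTop']
  intro r hr
  have h1 : Tendsto (fun m : ℕ => |a| ^ m * B) atTop (𝓝 (0 * B)) :=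
    (tendsto_pow_atTop_nhds_zero_of_lt_one (abs_nonneg a) ha).mul_const _
  rw [zero_mul] at h1
  obtain ⟨m, hm⟩ := (h1.eventually_lt_const (half_pos hr)).exists
  obtain ⟨N, hN⟩ := eventually_atTop.1 (key m j (r / 2) (half_pos hr))
  refine ⟨N, fun n hn => ?_⟩
  have hn0 : (0 : ℝ) < n := by exact_mod_cast (Nat.zero_le N).trans_lt hn
  rw [Real.dist_eq, sub_zero, avg, abs_div, Nat.abs_cast, div_lt_iff₀ hn0]
  have := hN n hn.le
  nlinarith

/-- An autoregression driven by innovations which are `o(n ^ (1 / 4))` is itself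
`o(n ^ (1 / 4))`. The scale is `(n + 1) ^ (1 / 4)`, so that it does not vanish at `n = 0`. -/
theorem autoregression_isLittleO {x e : ℕ → ℝ} {a : ℝ} (ha : |a| < 1)
    (hx : ∀ n, x (n + 1) = a * x n + e (n + 1))
    (he : Tendsto (fun n : ℕ => e n / √(√(n + 1))) atTop (𝓝 0)) :
    Tendsto (fun n : ℕ => x n / √(√(n + 1))) atTop (𝓝 0) := by
  rw [tendsto_zero_iff_abs_tendsto_zero] at he ⊢
  refine tendsto_zero_of_le_mul_add (abs_nonneg a) ha (fun n => abs_nonneg _)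
    (he.comp (tendsto_add_atTop_nat 1)) fun n => ?_
  simp only [Function.comp]
  have h1 : (0 : ℝ) < √(√(n + 1)) := by positivity
  have h2 : √(√((n : ℝ) + 1)) ≤ √(√(((n + 1 : ℕ) : ℝ) + 1)) := by
    gcongr
    linarith
  rw [hx n, add_div]
  refine (abs_add_le _ _).trans (add_le_add_left ?_ _)
  rw [abs_div, abs_mul, abs_div, mul_div_assoc, abs_of_pos h1, abs_of_pos (h1.trans_le h2)]
  gcongr

/-! ### Yule-Walker limits and the Durbin-Watson statistic -/

/-- The pathwise properties of the noise `v 1, v 2, …` that drive the law of large numbers for the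
autoregression: they hold almost surely for a centred i.i.d. noise with variance `σ ^ 2` and
finite fourth moment. The value `v 0` plays no role. -/
structure IsNoisePath (σ : ℝ) (v : ℕ → ℝ) : Prop where
  sq : Tendsto (avg fun k => v (k + 1) ^ 2) atTop (𝓝 (σ ^ 2))
  lag : LagUncorrelated (fun k => v (k + 1)) fun k => v (k + 1)
  growth : Tendsto (fun n : ℕ => v n / √(√(n + 1))) atTop (𝓝 0)

theorem LagUncorrelated.succ {x u : ℕ → ℝ} (h : LagUncorrelated x u) :
    LagUncorrelated (fun k => x (k + 1)) fun k => u (k + 1) := by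
  intro j
  refine (tendsto_avg_succ (h j)).congr fun n => ?_
  simp only [avg]
  congr 1
  refine Finset.sum_congr rfl fun k _ => ?_
  rw [show k + 1 + 1 + j = k + 1 + j + 1 by ring]

theorem tendsto_sq_div_sqrt {x : ℕ → ℝ}
    (h : Tendsto (fun n : ℕ => x n / √(√(n + 1))) atTop (𝓝 0)) :
    Tendsto (fun n : ℕ => x n ^ 2 / √(n + 1)) atTop (𝓝 0) := by
  have h1 := h.pow 2
  rw [zero_pow two_ne_zero] at h1
  refine h1.congr fun n => ?_
  rw [div_pow, Real.sq_sqrt (Real.sqrt_nonneg _)]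

theorem tendsto_shift_sq_div {x : ℕ → ℝ}
    (h : Tendsto (fun n : ℕ => x n / √(√(n + 1))) atTop (𝓝 0)) (i : ℕ) :
    Tendsto (fun n : ℕ => x (n + i) ^ 2 / n) atTop (𝓝 0) := by
  have h1 : Tendsto (fun n : ℕ => x n ^ 2 / ((n : ℝ) + 1)) atTop (𝓝 0) := by
    refine squeeze_zero (fun n => by positivity) (fun n => ?_) (tendsto_sq_div_sqrt h)
    have : √((n : ℝ) + 1) ≤ n + 1 := by
      rw [Real.sqrt_le_left (by positivity)]
      nlinarith [Nat.cast_nonneg (α := ℝ) n]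
    gcongr
  have h2 := (h1.comp (tendsto_add_atTop_nat i)).mul
    ((tendsto_const_nhds (x := (1 : ℝ))).add (tendsto_const_div_natCast ((i : ℝ) + 1)))
  rw [zero_mul] at h2
  refine h2.congr' ?_
  filter_upwards [eventually_gt_atTop 0] with n hn
  have : (0 : ℝ) < n := by positivity
  have h3 : ((n + i : ℕ) : ℝ) + 1 ≠ 0 := by positivity
  simp only [Function.comp]
  field_simp
  push_cast
  ring

theorem tendsto_shift_mul_div {x : ℕ → ℝ}
    (h : Tendsto (fun n : ℕ => x n / √(√(n + 1))) atTop (𝓝 0)) (i j : ℕ) :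
    Tendsto (fun n : ℕ => x (n + i) * x (n + j) / n) atTop (𝓝 0) := by
  have h1 := (tendsto_shift_sq_div h i).add (tendsto_shift_sq_div h j)
  rw [add_zero] at h1
  refine squeeze_zero_norm (fun n => ?_) h1
  rw [Real.norm_eq_abs, abs_div, Nat.abs_cast, ← add_div]
  gcongr
  rw [abs_le]
  constructor <;> nlinarith [sq_nonneg (x (n + i) + x (n + j)), sq_nonneg (x (n + i) - x (n + j))]

section Path

variable {θ ρ σ : ℝ} {x e v : ℕ → ℝ}

theorem IsNoisePath.sumSqLinear (hv : IsNoisePath σ v) : SumSqLinear v :=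
  sumSqLinear_of_tendsto_avg hv.sq

/-- An autoregression whose innovations are asymptotically uncorrelated with the later noise is
itself asymptotically uncorrelated with the later noise. -/
theorem IsNoisePath.lag_autoregression (hv : IsNoisePath σ v) (hρ : |ρ| < 1)
    (he : ∀ n, e (n + 1) = ρ * e n + v (n + 1)) : LagUncorrelated e v :=
  LagUncorrelated.autoregression hρ he (hv.sumSqLinear.autoregression hρ he) hv.sumSqLinear hv.lag

theorem IsNoisePath.lag_autoregression₂ (hv : IsNoisePath σ v) (hθ : |θ| < 1) (hρ : |ρ| < 1)
    (hx : ∀ n, x (n + 1) = θ * x n + e (n + 1)) (he : ∀ n, e (n + 1) = ρ * e n + v (n + 1)) :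
    LagUncorrelated x v :=
  LagUncorrelated.autoregression hθ hx
    ((hv.sumSqLinear.autoregression hρ he).autoregression hθ hx) hv.sumSqLinear
    (hv.lag_autoregression hρ he).succ

theorem IsNoisePath.growth_autoregression₂ (hv : IsNoisePath σ v) (hθ : |θ| < 1) (hρ : |ρ| < 1)
    (hx : ∀ n, x (n + 1) = θ * x n + e (n + 1)) (he : ∀ n, e (n + 1) = ρ * e n + v (n + 1)) :
    Tendsto (fun n : ℕ => x n / √(√(n + 1))) atTop (𝓝 0) :=
  autoregression_isLittleO hθ hx (autoregression_isLittleO hρ he hv.growth)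

/-- The limit of the empirical second moment of the process. -/
noncomputable def arVariance (θ ρ σ : ℝ) : ℝ :=
  σ ^ 2 * (1 + θ * ρ) / ((1 - θ ^ 2) * (1 - ρ ^ 2) * (1 - θ * ρ))

/-- The almost sure limit of the least squares estimator. -/
noncomputable def thetaLim (θ ρ : ℝ) : ℝ := (θ + ρ) / (1 + θ * ρ)

theorem abs_mul_lt_one (hθ : |θ| < 1) (hρ : |ρ| < 1) : |θ * ρ| < 1 := by
  rw [abs_mul]
  nlinarith [abs_nonneg θ, abs_nonneg ρ]

theorem arVariance_pos (hθ : |θ| < 1) (hρ : |ρ| < 1) (hσ : 0 < σ) : 0 < arVariance θ ρ σ := by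
  have h1 := abs_lt.1 (abs_mul_lt_one hθ hρ)
  have h2 : 0 < 1 - θ ^ 2 := by have := (sq_lt_one_iff_abs_lt_one θ).2 hθ; linarith
  have h3 : 0 < 1 - ρ ^ 2 := by have := (sq_lt_one_iff_abs_lt_one ρ).2 hρ; linarith
  have h4 : 0 < 1 + θ * ρ := by linarith
  have h5 : 0 < 1 - θ * ρ := by linarith
  unfold arVariance
  positivity

theorem one_sub_thetaLim_sq_pos (hθ : |θ| < 1) (hρ : |ρ| < 1) : 0 < 1 - thetaLim θ ρ ^ 2 := by
  have h1 := abs_lt.1 (abs_mul_lt_one hθ hρ)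
  have h2 : 0 < 1 - θ ^ 2 := by have := (sq_lt_one_iff_abs_lt_one θ).2 hθ; linarith
  have h3 : 0 < 1 - ρ ^ 2 := by have := (sq_lt_one_iff_abs_lt_one ρ).2 hρ; linarith
  have h4 : 0 < 1 + θ * ρ := by linarith
  have : 1 - thetaLim θ ρ ^ 2 = (1 - θ ^ 2) * (1 - ρ ^ 2) / (1 + θ * ρ) ^ 2 := by
    unfold thetaLim
    field_simp
    ring
  rw [this]
  positivity

theorem add_two_eq (hx : ∀ n, x (n + 1) = θ * x n + e (n + 1))
    (he : ∀ n, e (n + 1) = ρ * e n + v (n + 1)) (k : ℕ) :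
    x (k + 2) = (θ + ρ) * x (k + 1) - θ * ρ * x k + v (k + 2) := by
  rw [hx (k + 1), he (k + 1), hx k]
  ring

/-- The solution of the two Yule-Walker equations, perturbed by error terms: `s` and `c` stand for
the empirical second moment and lag one product, `z` for the empirical variance of the noise. -/
theorem yuleWalker_solve {s c s₁ s₂ c₁ u w z : ℝ} (hθ : |θ| < 1) (hρ : |ρ| < 1)
    (h1 : c₁ = (θ + ρ) * s₁ + (-(θ * ρ) * c + u))
    (h2 : s₂ = (θ + ρ) ^ 2 * s₁ + ((θ * ρ) ^ 2 * s + (z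
      + (-2 * (θ + ρ) * (θ * ρ) * c + (2 * (θ + ρ) * u + -2 * (θ * ρ) * w))))) :
    c = ((θ + ρ) * s + ((θ + ρ) * (s₁ - s) + u - (c₁ - c))) / (1 + θ * ρ) ∧
    s = (-(s₂ - s) + (θ + ρ) ^ 2 * (s₁ - s) + z
      - 2 * (θ + ρ) * (θ * ρ) / (1 + θ * ρ) * ((θ + ρ) * (s₁ - s) + u - (c₁ - c))
      + 2 * (θ + ρ) * u - 2 * (θ * ρ) * w)
      * ((1 + θ * ρ) / ((1 - θ ^ 2) * (1 - ρ ^ 2) * (1 - θ * ρ))) := by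
  have hq := abs_lt.1 (abs_mul_lt_one hθ hρ)
  have h3 : 0 < 1 - θ ^ 2 := by have := (sq_lt_one_iff_abs_lt_one θ).2 hθ; linarith
  have h4 : 0 < 1 - ρ ^ 2 := by have := (sq_lt_one_iff_abs_lt_one ρ).2 hρ; linarith
  have h5 : 0 < 1 + θ * ρ := by linarith
  have h6 : 0 < 1 - θ * ρ := by linarith
  have hc : c = ((θ + ρ) * s + ((θ + ρ) * (s₁ - s) + u - (c₁ - c))) / (1 + θ * ρ) := by
    rw [eq_div_iff h5.ne']
    linarith
  refine ⟨hc, ?_⟩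
  generalize (θ + ρ) * (s₁ - s) + u - (c₁ - c) = η at *
  have h7 : (1 + θ * ρ) * c = (θ + ρ) * s + η := by
    rw [hc, mul_div_cancel₀ _ h5.ne']
  rw [← mul_div_assoc, eq_div_iff (by positivity), ← sub_eq_zero]
  have h8 : 2 * (θ + ρ) * (θ * ρ) / (1 + θ * ρ) * η * (1 + θ * ρ)
      = 2 * (θ + ρ) * (θ * ρ) * η := by
    field_simp
  linear_combination h8 + (1 + θ * ρ) * h2 - 2 * (θ + ρ) * (θ * ρ) * h7

theorem avg_mul_succ_eq (hx : ∀ n, x (n + 1) = θ * x n + e (n + 1))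
    (he : ∀ n, e (n + 1) = ρ * e n + v (n + 1)) (n : ℕ) :
    avg (fun k => x (k + 2) * x (k + 1)) n = (θ + ρ) * avg (fun k => x (k + 1) ^ 2) n
      + (-(θ * ρ) * avg (fun k => x (k + 1) * x k) n
      + avg (fun k => x (k + 1) * v (k + 2)) n) := by
  rw [← avg_const_mul, ← avg_const_mul, ← avg_add, ← avg_add]
  congr 1
  funext k
  rw [add_two_eq hx he k]
  ring

theorem avg_sq_succ_eq (hx : ∀ n, x (n + 1) = θ * x n + e (n + 1))
    (he : ∀ n, e (n + 1) = ρ * e n + v (n + 1)) (n : ℕ) :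
    avg (fun k => x (k + 2) ^ 2) n = (θ + ρ) ^ 2 * avg (fun k => x (k + 1) ^ 2) n
      + ((θ * ρ) ^ 2 * avg (fun k => x k ^ 2) n + (avg (fun k => v (k + 2) ^ 2) n
      + (-2 * (θ + ρ) * (θ * ρ) * avg (fun k => x (k + 1) * x k) n
      + (2 * (θ + ρ) * avg (fun k => x (k + 1) * v (k + 2)) n
      + -2 * (θ * ρ) * avg (fun k => x k * v (k + 2)) n)))) := by
  simp only [avg, ← mul_div_assoc, ← add_div, Finset.mul_sum, ← Finset.sum_add_distrib]
  congr 1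
  refine Finset.sum_congr rfl fun k _ => ?_
  rw [add_two_eq hx he k]
  ring

/-- The law of large numbers for the quadratic and lag one statistics, from the two
Yule-Walker equations. -/
theorem IsNoisePath.tendsto_avg_sq_and_mul (hv : IsNoisePath σ v) (hθ : |θ| < 1) (hρ : |ρ| < 1)
    (hx : ∀ n, x (n + 1) = θ * x n + e (n + 1)) (he : ∀ n, e (n + 1) = ρ * e n + v (n + 1)) :
    Tendsto (avg fun k => x k ^ 2) atTop (𝓝 (arVariance θ ρ σ)) ∧
      Tendsto (avg fun k => x (k + 1) * x k) atTop (𝓝 (thetaLim θ ρ * arVariance θ ρ σ)) := by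
  have hg := hv.growth_autoregression₂ hθ hρ hx he
  have hl := hv.lag_autoregression₂ hθ hρ hx he
  let s := avg fun k => x k ^ 2
  let c := avg fun k => x (k + 1) * x k
  -- replacing an average by its shift costs a vanishing boundary term
  have hβ : Tendsto (fun n => (avg (fun k => x (k + 1) ^ 2) n) - s n) atTop (𝓝 0) := by
    have := (tendsto_shift_sq_div hg 0).sub (tendsto_const_div_natCast (x 0 ^ 2))
    rw [sub_zero] at this
    refine this.congr fun n => ?_
    rw [avg_succ_sub (f := fun k => x k ^ 2)]
    simp [s]
  have hγ : Tendsto (fun n => (avg (fun k => x (k + 2) ^ 2) n) - s n) atTop (𝓝 0) := by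
    have := ((tendsto_shift_sq_div hg 1).sub (tendsto_const_div_natCast (x 1 ^ 2))).add hβ
    rw [sub_zero, add_zero] at this
    refine this.congr fun n => ?_
    rw [avg_succ_sub (f := fun k => x (k + 1) ^ 2)]
    simp only [zero_add]
    ring
  have hα : Tendsto (fun n => (avg (fun k => x (k + 2) * x (k + 1)) n) - c n) atTop (𝓝 0) := by
    have := (tendsto_shift_mul_div hg 1 0).sub (tendsto_const_div_natCast (x 1 * x 0))
    rw [sub_zero] at this
    refine this.congr fun n => ?_
    rw [avg_succ_sub (f := fun k => x (k + 1) * x k)]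
    simp [c]
  have hu : Tendsto (avg fun k => x (k + 1) * v (k + 2)) atTop (𝓝 0) := by
    simpa only [add_assoc, Nat.reduceAdd] using tendsto_avg_succ (hl 0)
  have hw : Tendsto (avg fun k => x k * v (k + 2)) atTop (𝓝 0) := by
    simpa only [add_assoc, Nat.reduceAdd] using hl 1
  have hz : Tendsto (avg fun k => v (k + 2) ^ 2) atTop (𝓝 (σ ^ 2)) := by
    simpa only [add_assoc, Nat.reduceAdd] using tendsto_avg_succ hv.sq
  have e1 := avg_mul_succ_eq hx he
  have e2 := avg_sq_succ_eq hx he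
  have hη : Tendsto (fun n => (θ + ρ) * (avg (fun k => x (k + 1) ^ 2) n - s n)
      + avg (fun k => x (k + 1) * v (k + 2)) n
      - (avg (fun k => x (k + 2) * x (k + 1)) n - c n)) atTop (𝓝 0) := by
    have := ((hβ.const_mul (θ + ρ)).add hu).sub hα
    simpa using this
  have hs_lim : Tendsto s atTop (𝓝 (arVariance θ ρ σ)) := by
    have := (((((hγ.neg.add (hβ.const_mul ((θ + ρ) ^ 2))).add hz).sub
      (hη.const_mul (2 * (θ + ρ) * (θ * ρ) / (1 + θ * ρ)))).add (hu.const_mul (2 * (θ + ρ)))).sub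
      (hw.const_mul (2 * (θ * ρ)))).mul_const
        ((1 + θ * ρ) / ((1 - θ ^ 2) * (1 - ρ ^ 2) * (1 - θ * ρ)))
    simp only [mul_zero, neg_zero, add_zero, zero_add, sub_zero] at this
    rw [← mul_div_assoc] at this
    exact this.congr fun n => (yuleWalker_solve hθ hρ (e1 n) (e2 n)).2.symm
  refine ⟨hs_lim, ?_⟩
  have := ((hs_lim.const_mul (θ + ρ)).add hη).div_const (1 + θ * ρ)
  rw [add_zero, mul_div_right_comm] at this
  exact this.congr fun n => (yuleWalker_solve hθ hρ (e1 n) (e2 n)).1.symm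

theorem IsNoisePath.tendsto_avg_mul_lag_two (hv : IsNoisePath σ v) (hθ : |θ| < 1) (hρ : |ρ| < 1)
    (hx : ∀ n, x (n + 1) = θ * x n + e (n + 1)) (he : ∀ n, e (n + 1) = ρ * e n + v (n + 1)) :
    Tendsto (avg fun k => x (k + 2) * x k) atTop
      (𝓝 (((θ + ρ) * thetaLim θ ρ - θ * ρ) * arVariance θ ρ σ)) := by
  obtain ⟨h1, h2⟩ := hv.tendsto_avg_sq_and_mul hθ hρ hx he
  have h3 := ((h2.const_mul (θ + ρ)).add (h1.const_mul (-(θ * ρ)))).add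
    (hv.lag_autoregression₂ hθ hρ hx he 1)
  rw [show (θ + ρ) * (thetaLim θ ρ * arVariance θ ρ σ) + -(θ * ρ) * arVariance θ ρ σ + 0
    = ((θ + ρ) * thetaLim θ ρ - θ * ρ) * arVariance θ ρ σ by ring] at h3
  refine h3.congr fun n => ?_
  rw [← avg_const_mul, ← avg_const_mul, ← avg_add, ← avg_add]
  congr 1
  funext k
  rw [add_two_eq hx he k]
  ring

end Path

section Statistic

variable {x : ℕ → ℝ}

/-- Least squares orthogonality, which makes the lag one products of the residuals telescope into
`θ̂` times a lag two statistic. -/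
theorem sum_lsResidual_mul_lsResidual {n : ℕ}
    (hS : ∑ k ∈ Finset.range (n + 1), x k ^ 2 ≠ 0) :
    ∑ k ∈ Finset.range (n + 1), lsResidual x (n + 1) (k + 1) * lsResidual x (n + 1) k
      = -thetaHat x (n + 1) * (∑ k ∈ Finset.range n, x (k + 2) * x k
        - thetaHat x (n + 1) * ∑ k ∈ Finset.range n, x (k + 1) * x k) := by
  have horth : ∑ k ∈ Finset.range (n + 1), lsResidual x (n + 1) (k + 1) * x k = 0 := by
    have h1 : thetaHat x (n + 1) * ∑ k ∈ Finset.range (n + 1), x k ^ 2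
        = ∑ k ∈ Finset.range (n + 1), x (k + 1) * x k := div_mul_cancel₀ _ hS
    rw [Finset.mul_sum] at h1
    rw [← sub_eq_zero, ← Finset.sum_sub_distrib] at h1
    rw [← neg_eq_zero, ← Finset.sum_neg_distrib, ← h1]
    refine Finset.sum_congr rfl fun k _ => ?_
    simp only [lsResidual]
    ring
  rw [Finset.sum_range_succ'] at horth ⊢
  rw [← sub_eq_zero, ← sub_eq_zero.2 horth, Finset.mul_sum, ← Finset.sum_sub_distrib,
    Finset.mul_sum]
  rw [← sub_eq_zero]
  have h2 : ∑ k ∈ Finset.range n, (lsResidual x (n + 1) (k + 1 + 1) * lsResidual x (n + 1) (k + 1)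
      - (lsResidual x (n + 1) (k + 1 + 1) * x (k + 1)
      + -thetaHat x (n + 1) * (x (k + 2) * x k - thetaHat x (n + 1) * (x (k + 1) * x k)))) = 0 := by
    refine Finset.sum_eq_zero fun k _ => ?_
    simp only [lsResidual]
    ring
  simp only [Finset.sum_sub_distrib, Finset.sum_add_distrib, ← Finset.mul_sum] at h2 ⊢
  simp only [lsResidual] at h2 ⊢
  linarith

theorem sum_lsResidual_sq {n : ℕ} (hS : ∑ k ∈ Finset.range (n + 1), x k ^ 2 ≠ 0) :
    ∑ k ∈ Finset.range (n + 2), lsResidual x (n + 1) k ^ 2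
      = ∑ k ∈ Finset.range (n + 2), x k ^ 2
        - thetaHat x (n + 1) ^ 2 * ∑ k ∈ Finset.range (n + 1), x k ^ 2 := by
  have h1 : thetaHat x (n + 1) * ∑ k ∈ Finset.range (n + 1), x k ^ 2
      = ∑ k ∈ Finset.range (n + 1), x (k + 1) * x k := div_mul_cancel₀ _ hS
  have h2 : ∑ k ∈ Finset.range (n + 1), lsResidual x (n + 1) (k + 1) ^ 2
      = ∑ k ∈ Finset.range (n + 1), x (k + 1) ^ 2
        - 2 * thetaHat x (n + 1) * ∑ k ∈ Finset.range (n + 1), x (k + 1) * x k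
        + thetaHat x (n + 1) ^ 2 * ∑ k ∈ Finset.range (n + 1), x k ^ 2 := by
    rw [Finset.mul_sum, Finset.mul_sum, ← Finset.sum_sub_distrib, ← Finset.sum_add_distrib]
    refine Finset.sum_congr rfl fun k _ => ?_
    simp only [lsResidual]
    ring
  rw [Finset.sum_range_succ', Finset.sum_range_succ' _ (n + 1), h2, ← h1]
  simp only [lsResidual]
  ring

/-- The deviation of the Durbin-Watson statistic from `2`, in terms of lag one and lag two
statistics and two boundary terms. -/
theorem durbinWatson_sub_two {n : ℕ} (hS : ∑ k ∈ Finset.range (n + 1), x k ^ 2 ≠ 0)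
    (hJ : ∑ k ∈ Finset.range (n + 2), lsResidual x (n + 1) k ^ 2 ≠ 0) :
    durbinWatson x (n + 1) - 2
      = (2 * thetaHat x (n + 1) * (∑ k ∈ Finset.range n, x (k + 2) * x k
          - thetaHat x (n + 1) * ∑ k ∈ Finset.range n, x (k + 1) * x k)
          - x 0 ^ 2 - (x (n + 1) - thetaHat x (n + 1) * x n) ^ 2)
        / ∑ k ∈ Finset.range (n + 2), lsResidual x (n + 1) k ^ 2 := by
  rw [eq_div_iff hJ, sub_mul, durbinWatson, div_mul_cancel₀ _ hJ]
  have h1 := sum_lsResidual_mul_lsResidual hS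
  have h2 := Finset.sum_range_succ (fun k => lsResidual x (n + 1) k ^ 2) (n + 1)
  have h3 := Finset.sum_range_succ' (fun k => lsResidual x (n + 1) k ^ 2) (n + 1)
  have h4 : ∑ k ∈ Finset.range (n + 1), (lsResidual x (n + 1) (k + 1) - lsResidual x (n + 1) k) ^ 2
      = ∑ k ∈ Finset.range (n + 1), lsResidual x (n + 1) (k + 1) ^ 2
        + ∑ k ∈ Finset.range (n + 1), lsResidual x (n + 1) k ^ 2
        - 2 * ∑ k ∈ Finset.range (n + 1), lsResidual x (n + 1) (k + 1) * lsResidual x (n + 1) k := by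
    rw [Finset.mul_sum, ← Finset.sum_add_distrib, ← Finset.sum_sub_distrib]
    refine Finset.sum_congr rfl fun k _ => ?_
    ring
  have h5 : lsResidual x (n + 1) 0 = x 0 := rfl
  have h6 : lsResidual x (n + 1) (n + 1) = x (n + 1) - thetaHat x (n + 1) * x n := rfl
  rw [h5] at h3
  rw [h6] at h2
  rw [h4, h1]
  linarith

end Statistic

section Limits

variable {θ ρ σ : ℝ} {x e v : ℕ → ℝ}

theorem IsNoisePath.tendsto_thetaHat (hv : IsNoisePath σ v) (hθ : |θ| < 1) (hρ : |ρ| < 1)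
    (hσ : 0 < σ)
    (hx : ∀ n, x (n + 1) = θ * x n + e (n + 1)) (he : ∀ n, e (n + 1) = ρ * e n + v (n + 1)) :
    Tendsto (thetaHat x) atTop (𝓝 (thetaLim θ ρ)) := by
  obtain ⟨h1, h2⟩ := hv.tendsto_avg_sq_and_mul hθ hρ hx he
  have hs := (arVariance_pos hθ hρ hσ).ne'
  have h3 := h2.div h1 hs
  rw [mul_div_cancel_right₀ _ hs] at h3
  refine h3.congr' ?_
  filter_upwards [eventually_gt_atTop 0] with n hn
  have : (n : ℝ) ≠ 0 := by positivity
  simp only [avg, Pi.div_apply]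
  rw [div_div_div_cancel_right₀ this]
  rfl

theorem IsNoisePath.eventually_sum_sq_ne_zero (hv : IsNoisePath σ v) (hθ : |θ| < 1) (hρ : |ρ| < 1)
    (hσ : 0 < σ)
    (hx : ∀ n, x (n + 1) = θ * x n + e (n + 1)) (he : ∀ n, e (n + 1) = ρ * e n + v (n + 1)) :
    ∀ᶠ n in atTop, ∑ k ∈ Finset.range (n + 1), x k ^ 2 ≠ 0 := by
  have h1 := ((hv.tendsto_avg_sq_and_mul hθ hρ hx he).1.comp
    (tendsto_add_atTop_nat 1)).eventually_ne (arVariance_pos hθ hρ hσ).ne'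
  filter_upwards [h1] with n hn h0
  simp [avg, h0] at hn

theorem IsNoisePath.tendsto_sum_lsResidual_sq (hv : IsNoisePath σ v) (hθ : |θ| < 1)
    (hρ : |ρ| < 1) (hσ : 0 < σ)
    (hx : ∀ n, x (n + 1) = θ * x n + e (n + 1)) (he : ∀ n, e (n + 1) = ρ * e n + v (n + 1)) :
    Tendsto (fun n : ℕ => (∑ k ∈ Finset.range (n + 2), lsResidual x (n + 1) k ^ 2) / n) atTop
      (𝓝 ((1 - thetaLim θ ρ ^ 2) * arVariance θ ρ σ)) := by
  have h1 := (hv.tendsto_avg_sq_and_mul hθ hρ hx he).1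
  have hg := hv.growth_autoregression₂ hθ hρ hx he
  have ht := (hv.tendsto_thetaHat hθ hρ hσ hx he).comp (tendsto_add_atTop_nat 1)
  have h2 := ((h1.add (tendsto_shift_sq_div hg 0)).add (tendsto_shift_sq_div hg 1)).sub
    ((ht.pow 2).mul (h1.add (tendsto_shift_sq_div hg 0)))
  rw [show arVariance θ ρ σ + 0 + 0 - thetaLim θ ρ ^ 2 * (arVariance θ ρ σ + 0)
    = (1 - thetaLim θ ρ ^ 2) * arVariance θ ρ σ by ring] at h2
  refine h2.congr' ?_
  filter_upwards [hv.eventually_sum_sq_ne_zero hθ hρ hσ hx he] with n hn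
  rw [sum_lsResidual_sq hn, Finset.sum_range_succ _ (n + 1), Finset.sum_range_succ _ n]
  simp only [avg, Function.comp, add_zero]
  ring

/-- The Durbin-Watson statistic converges to `2 (1 - θ ρ θ*)`, where `θ*` is the limit of the least
squares estimator. -/
theorem IsNoisePath.tendsto_durbinWatson (hv : IsNoisePath σ v) (hθ : |θ| < 1) (hρ : |ρ| < 1)
    (hσ : 0 < σ)
    (hx : ∀ n, x (n + 1) = θ * x n + e (n + 1)) (he : ∀ n, e (n + 1) = ρ * e n + v (n + 1)) :
    Tendsto (fun n => durbinWatson x n - 2) atTop (𝓝 (-2 * (θ * ρ * thetaLim θ ρ))) := by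
  rw [← tendsto_add_atTop_iff_nat 1]
  have hs := arVariance_pos hθ hρ hσ
  have hτ := one_sub_thetaLim_sq_pos hθ hρ
  have hq := abs_lt.1 (abs_mul_lt_one hθ hρ)
  have hJ := hv.tendsto_sum_lsResidual_sq hθ hρ hσ hx he
  have hJ0 : (1 - thetaLim θ ρ ^ 2) * arVariance θ ρ σ ≠ 0 := by positivity
  have hg := hv.growth_autoregression₂ hθ hρ hx he
  have ht := (hv.tendsto_thetaHat hθ hρ hσ hx he).comp (tendsto_add_atTop_nat 1)
  have hc2 := hv.tendsto_avg_mul_lag_two hθ hρ hx he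
  have hc := (hv.tendsto_avg_sq_and_mul hθ hρ hx he).2
  have hb := ((tendsto_shift_sq_div hg 1).sub
    ((ht.const_mul 2).mul (tendsto_shift_mul_div hg 1 0))).add
    ((ht.pow 2).mul (tendsto_shift_sq_div hg 0))
  have h1 := ((((ht.const_mul 2).mul (hc2.sub (ht.mul hc))).sub
    (tendsto_const_div_natCast (x 0 ^ 2))).sub hb).div hJ hJ0
  have h2 : (2 * thetaLim θ ρ * (((θ + ρ) * thetaLim θ ρ - θ * ρ) * arVariance θ ρ σ
      - thetaLim θ ρ * (thetaLim θ ρ * arVariance θ ρ σ)) - 0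
      - (0 - 2 * thetaLim θ ρ * 0 + thetaLim θ ρ ^ 2 * 0))
      / ((1 - thetaLim θ ρ ^ 2) * arVariance θ ρ σ) = -2 * (θ * ρ * thetaLim θ ρ) := by
    rw [div_eq_iff hJ0]
    have : θ + ρ = thetaLim θ ρ * (1 + θ * ρ) := by
      rw [thetaLim, div_mul_cancel₀]
      linarith
    rw [this]
    ring
  rw [h2] at h1
  refine h1.congr' ?_
  filter_upwards [hv.eventually_sum_sq_ne_zero hθ hρ hσ hx he, hJ.eventually_ne hJ0,
    eventually_gt_atTop 0] with n hn hJn hn0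
  have hn1 : (n : ℝ) ≠ 0 := by positivity
  rw [durbinWatson_sub_two hn (fun h => hJn (by rw [h, zero_div]))]
  simp only [Pi.div_apply, avg, Function.comp, add_zero]
  rw [div_div_eq_mul_div]
  congr 1
  field_simp
  ring

/-- Under the alternative, the test statistic diverges on every path along which the law of large
numbers holds. -/
theorem IsNoisePath.tendsto_dwTestStatistic_atTop (hv : IsNoisePath σ v) (hθ : |θ| < 1)
    (hρ : |ρ| < 1) (hσ : 0 < σ) (hθ0 : θ ≠ 0) (hρ0 : ρ ≠ 0) (hθρ : θ ≠ -ρ)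
    (hx : ∀ n, x (n + 1) = θ * x n + e (n + 1)) (he : ∀ n, e (n + 1) = ρ * e n + v (n + 1)) :
    Tendsto (dwTestStatistic x) atTop atTop := by
  have hq := abs_lt.1 (abs_mul_lt_one hθ hρ)
  have ht0 : thetaLim θ ρ ≠ 0 :=
    div_ne_zero (fun h => hθρ (eq_neg_of_add_eq_zero_left h)) (by linarith)
  have ht := hv.tendsto_thetaHat hθ hρ hσ hx he
  have hD := hv.tendsto_durbinWatson hθ hρ hσ hx he
  have h1 := (hD.pow 2).div ((ht.pow 2).const_mul 4) (by positivity)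
  have h2 : 0 < (-2 * (θ * ρ * thetaLim θ ρ)) ^ 2 / (4 * thetaLim θ ρ ^ 2) := by positivity
  refine (tendsto_natCast_atTop_atTop.atTop_mul_pos h2 h1).congr fun n => ?_
  simp only [dwTestStatistic, Pi.div_apply]
  ring

end Limits

/-! ### Almost sure properties of the noise -/

/-- If the averages of `f` along each residue class modulo `q` tend to zero, so do the averages of
`f`. -/
theorem tendsto_avg_of_residues {f : ℕ → ℝ} {q : ℕ} (hq : 0 < q)
    (h : ∀ r < q, Tendsto (avg fun m => f (r + m * q)) atTop (𝓝 0)) :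
    Tendsto (avg f) atTop (𝓝 0) := by
  -- `A` collects the complete blocks of length `q`, and `G` also bounds the incomplete one
  set A : ℕ → ℝ := fun N => ∑ k ∈ Finset.range (N * q), f k with hA
  set G : ℕ → ℝ := fun N => (|A N| + ∑ r ∈ Finset.range q, |f (r + N * q)|) / N with hG
  have hA_eq : ∀ N, A N = ∑ r ∈ Finset.range q, ∑ m ∈ Finset.range N, f (r + m * q) := by
    intro N
    induction N with
    | zero => simp [hA]
    | succ N ih =>
      simp only [hA, Finset.sum_range_succ _ N, Finset.sum_add_distrib] at ih ⊢
      rw [Nat.succ_mul, Finset.sum_range_add, ih]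
      simp only [add_comm (N * q)]
  have hG_lim : Tendsto G atTop (𝓝 0) := by
    have h1 : Tendsto (fun N => ∑ r ∈ Finset.range q, avg (fun m => f (r + m * q)) N) atTop
        (𝓝 (∑ r ∈ Finset.range q, 0)) :=
      tendsto_finsetSum _ fun r hr => h r (Finset.mem_range.1 hr)
    have h2 : Tendsto (fun N : ℕ => ∑ r ∈ Finset.range q, |f (r + N * q) / N|) atTop
        (𝓝 (∑ r ∈ Finset.range q, |0|)) :=
      tendsto_finsetSum _ fun r hr =>
        (tendsto_div_of_tendsto_avg (h r (Finset.mem_range.1 hr))).abs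
    have h3 := h1.abs.add h2
    simp only [abs_zero, Finset.sum_const_zero, add_zero] at h3
    refine h3.congr fun N => ?_
    simp only [hG, hA_eq, avg, ← Finset.sum_div, abs_div, Nat.abs_cast, add_div]
  refine squeeze_zero_norm' ?_ (hG_lim.comp (Nat.tendsto_div_const_atTop hq.ne'))
  filter_upwards [eventually_ge_atTop q] with n hn
  have hN : 0 < n / q := Nat.div_pos hn hq
  have hNn : ((n / q : ℕ) : ℝ) ≤ n := by exact_mod_cast Nat.div_le_self n q
  have hN' : (0 : ℝ) < (n / q : ℕ) := by exact_mod_cast hN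
  have h1 : ∑ k ∈ Finset.range n, f k
      = A (n / q) + ∑ i ∈ Finset.range (n % q), f (i + n / q * q) := by
    conv_lhs => rw [← Nat.div_add_mod' n q, Finset.sum_range_add]
    simp only [hA, add_comm (n / q * q)]
  have h2 : |∑ k ∈ Finset.range n, f k|
      ≤ |A (n / q)| + ∑ r ∈ Finset.range q, |f (r + n / q * q)| := by
    rw [h1]
    refine (abs_add_le _ _).trans (add_le_add_right ((Finset.abs_sum_le_sum_abs _ _).trans ?_) _)
    exact Finset.sum_le_sum_of_subset_of_nonneg (Finset.range_mono (Nat.mod_lt n hq).le)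
      fun _ _ _ => abs_nonneg _
  simp only [Function.comp, hG]
  rw [Real.norm_eq_abs, avg, abs_div, Nat.abs_cast]
  exact (div_le_div_of_nonneg_right h2 (by positivity)).trans
    (div_le_div_of_nonneg_left ((abs_nonneg _).trans h2) hN' hNn)

section Noise

variable {Ω : Type*} [MeasurableSpace Ω] {P : Measure Ω} {ξ : ℕ → Ω → ℝ} {σ : ℝ}

/-- The products of an i.i.d. centred noise at a fixed positive lag obey the strong law of large
numbers: along a residue class modulo `j + 2` the products at lag `j + 1` are independent. -/
theorem ae_tendsto_avg_mul_lag [IsProbabilityMeasure P] (hindep : iIndepFun ξ P)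
    (hident : ∀ n, IdentDistrib (ξ n) (ξ 0) P P) (hint : Integrable (ξ 0) P)
    (hmean : ∫ ω, ξ 0 ω ∂P = 0) (j : ℕ) :
    ∀ᵐ ω ∂P, Tendsto (avg fun k => ξ k ω * ξ (k + 1 + j) ω) atTop (𝓝 0) := by
  have hmeas : ∀ n, AEMeasurable (ξ n) P := fun n => (hident n).aemeasurable_fst
  have hpair : ∀ k, IndepFun (ξ k) (ξ (k + 1 + j)) P := fun k => hindep.indepFun (by omega)
  have hint' : ∀ n, Integrable (ξ n) P := fun n => (hident n).integrable_iff.2 hint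
  have hmain : ∀ r, ∀ᵐ ω ∂P, Tendsto (fun n : ℕ => (∑ m ∈ Finset.range n,
      (fun m => ξ (r + m * (j + 2)) * ξ (r + m * (j + 2) + 1 + j)) m ω) / (n : ℝ)) atTop
      (𝓝 (∫ ω, (ξ (r + 0 * (j + 2)) * ξ (r + 0 * (j + 2) + 1 + j)) ω ∂P)) := by
    intro r
    refine strong_law_ae_real (fun m => ξ (r + m * (j + 2)) * ξ (r + m * (j + 2) + 1 + j))
      ((hpair _).integrable_mul (hint' _) (hint' _)) ?_ ?_
    · intro m m' hmm
      have h1 : m * (j + 2) ≠ m' * (j + 2) := fun h => hmm (Nat.eq_of_mul_eq_mul_right (by omega) h)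
      have h2 : ∀ a b : ℕ, a * (j + 2) ≠ b * (j + 2) + (1 + j) := by
        intro a b h
        have h3 := congrArg (· % (j + 2)) h
        simp only [Nat.mul_mod_left, Nat.mul_add_mod_self_right] at h3
        rw [Nat.mod_eq_of_lt (by omega)] at h3
        omega
      have h3 := h2 m m'
      have h4 := h2 m' m
      exact hindep.indepFun_mul_mul₀ hmeas _ _ _ _ (by omega) (by omega) (by omega) (by omega)
    · intro m
      exact (IdentDistrib.prodMk ((hident _).trans (hident _).symm)
        ((hident _).trans (hident _).symm) (hpair _) (hpair _)).comp
        (u := fun p : ℝ × ℝ => p.1 * p.2) (by fun_prop)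
  have hzero : ∀ k, ∫ ω, (ξ k * ξ (k + 1 + j)) ω ∂P = 0 := by
    intro k
    rw [(hpair k).integral_mul_eq_mul_integral (hmeas _).aestronglyMeasurable
      (hmeas _).aestronglyMeasurable, (hident k).integral_eq, hmean, zero_mul]
  filter_upwards [ae_all_iff.2 hmain] with ω hω
  refine tendsto_avg_of_residues (q := j + 2) (by omega) fun r _ => ?_
  have := hω r
  rw [hzero] at this
  exact this

/-- The strong law of large numbers for the powers of an i.i.d. noise. -/
theorem ae_tendsto_avg_pow (hindep : iIndepFun ξ P)
    (hident : ∀ n, IdentDistrib (ξ n) (ξ 0) P P) (p : ℕ)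
    (hint : Integrable (fun ω => ξ 0 ω ^ p) P) :
    ∀ᵐ ω ∂P, Tendsto (avg fun k => ξ k ω ^ p) atTop (𝓝 (∫ ω, ξ 0 ω ^ p ∂P)) :=
  strong_law_ae_real (fun k ω => ξ k ω ^ p) hint
    (fun i j hij => (hindep.indepFun hij).comp (φ := fun x => x ^ p) (ψ := fun x => x ^ p)
      (by fun_prop) (by fun_prop))
    fun n => (hident n).comp (u := fun x => x ^ p) (by fun_prop)

theorem tendsto_div_sqrt_sqrt {v : ℕ → ℝ} {l : ℝ}
    (h : Tendsto (avg fun k => v (k + 1) ^ 4) atTop (𝓝 l)) :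
    Tendsto (fun n : ℕ => v n / √(√(n + 1))) atTop (𝓝 0) := by
  have h1 : Tendsto (fun n : ℕ => √(√(v (n + 1) ^ 4 / n))) atTop (𝓝 0) := by
    have h2 : Continuous fun x : ℝ => √(√x) := by fun_prop
    have := (h2.tendsto 0).comp (tendsto_div_of_tendsto_avg h)
    simpa only [Real.sqrt_zero, Function.comp_def] using this
  rw [← tendsto_add_atTop_iff_nat 1]
  refine squeeze_zero_norm' ?_ h1
  filter_upwards [eventually_gt_atTop 0] with n hn
  have hn' : (0 : ℝ) < n := by positivity
  have h3 : √(√(v (n + 1) ^ 4)) = |v (n + 1)| := by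
    rw [show v (n + 1) ^ 4 = (v (n + 1) ^ 2) ^ 2 by ring, Real.sqrt_sq (sq_nonneg _),
      Real.sqrt_sq_eq_abs]
  rw [Real.sqrt_div (by positivity), Real.sqrt_div (by positivity), h3, norm_div,
    Real.norm_eq_abs, Real.norm_of_nonneg (by positivity)]
  gcongr
  push_cast
  linarith

theorem ae_isNoisePath [IsProbabilityMeasure P] {V : ℕ → Ω → ℝ}
    (hV_indep : iIndepFun (fun n => V (n + 1)) P)
    (hV_ident : ∀ n, IdentDistrib (V (n + 1)) (V 1) P P)
    (hV_mean : ∫ ω, V 1 ω ∂P = 0) (hV_var : variance (V 1) P = σ ^ 2)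
    (hV_four : MemLp (V 1) 4 P) :
    ∀ᵐ ω ∂P, IsNoisePath σ fun n => V n ω := by
  have hint4 : Integrable (fun ω => V 1 ω ^ 4) P := by
    have := hV_four.integrable_norm_pow (p := 4) (by norm_num)
    simpa only [Real.norm_eq_abs, Even.pow_abs (by decide : Even 4)] using this
  have hint2 : Integrable (fun ω => V 1 ω ^ 2) P :=
    (hV_four.mono_exponent (by norm_num) : MemLp (V 1) 2 P).integrable_sq
  have hint1 : Integrable (V 1) P := hV_four.integrable (by norm_num)
  have hsq : ∫ ω, V 1 ω ^ 2 ∂P = σ ^ 2 := by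
    rw [← hV_var, variance_of_integral_eq_zero (hV_ident 0).aemeasurable_snd hV_mean]
  filter_upwards [ae_all_iff.2 (ae_tendsto_avg_mul_lag hV_indep hV_ident hint1 hV_mean),
    ae_tendsto_avg_pow hV_indep hV_ident 2 hint2, ae_tendsto_avg_pow hV_indep hV_ident 4 hint4]
    with ω h1 h2 h3
  exact ⟨hsq ▸ h2, h1, tendsto_div_sqrt_sqrt h3⟩

end Noise

/-! ### A central limit theorem for martingale transforms of an i.i.d. noise -/

/-- Keeping only the terms at which the running total of the original sequence is at most `L`
leaves a sum which is at most `L`. -/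
theorem sum_truncated_le {a : ℕ → ℝ} (ha : ∀ k, 0 ≤ a k) {L : ℝ} (hL : 0 ≤ L) (m : ℕ) :
    ∑ k ∈ Finset.range m, (if ∑ j ∈ Finset.range (k + 1), a j ≤ L then a k else 0) ≤ L := by
  induction m with
  | zero => simpa
  | succ m ih =>
    by_cases h : ∑ j ∈ Finset.range (m + 1), a j ≤ L
    · refine (Finset.sum_le_sum fun k _ => ?_).trans h
      split_ifs
      exacts [le_rfl, ha k]
    · rw [Finset.sum_range_succ, if_neg h, add_zero]
      exact ih

/-- The deviation of the characteristic function of `μ` from the one of the centred Gaussian law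
with variance `v`. -/
noncomputable def charFunError (μ : Measure ℝ) (v u : ℝ) : ℝ :=
  ‖charFun μ u - Complex.exp ((-(v * u ^ 2 / 2) : ℝ) : ℂ)‖

section CharFunError

variable {μ : Measure ℝ} {v : ℝ}

theorem charFunError_nonneg (u : ℝ) : 0 ≤ charFunError μ v u := norm_nonneg _

variable [IsProbabilityMeasure μ]

theorem measurable_charFunError : Measurable (charFunError μ v) := by
  unfold charFunError
  have := continuous_charFun (μ := μ)
  fun_prop

theorem charFunError_le_two (hv : 0 ≤ v) (u : ℝ) : charFunError μ v u ≤ 2 := by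
  refine (norm_sub_le _ _).trans ?_
  have h1 : ‖charFun μ u‖ ≤ 1 := norm_charFun_le_one u
  have h2 : ‖Complex.exp ((-(v * u ^ 2 / 2) : ℝ) : ℂ)‖ ≤ 1 := by
    rw [Complex.norm_exp_ofReal, Real.exp_le_one_iff]
    have : 0 ≤ v * u ^ 2 / 2 := by positivity
    linarith
  linarith

theorem charFunError_isLittleO (hint : MemLp id 2 μ) (hmean : ∫ x, x ∂μ = 0)
    (hvar : ∫ x, x ^ 2 ∂μ = v) :
    (charFunError μ v) =o[𝓝 0] fun u : ℝ => u ^ 2 := by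
  unfold charFunError
  rw [Asymptotics.isLittleO_norm_left]
  have h1 : (fun u : ℝ => charFun μ u - (1 - v * u ^ 2 / 2 : ℝ)) =o[𝓝 0] fun u : ℝ => u ^ 2 := by
    have h2 := taylor_isLittleO_univ (f := charFun μ) (n := 2) (x₀ := 0) (contDiff_charFun hint)
    have h3 : ∀ u, taylorWithinEval (charFun μ) 2 Set.univ 0 u = ((1 - v * u ^ 2 / 2 : ℝ) : ℂ) := by
      intro u
      have := taylorWithinEval_charFun_two_zero (P := μ) (X := id) aemeasurable_id
        (by simpa using hint) u
      rw [Measure.map_id] at this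
      rw [this]
      have h4 : (∫ x, id x ∂μ) = 0 := hmean
      have h5 : (∫ x, (id ^ 2 : ℝ → ℝ) x ∂μ) = v := hvar
      rw [h4, h5]
      push_cast
      ring
    simpa only [h3, sub_zero] using h2
  have h2 : (fun u : ℝ => ((1 - v * u ^ 2 / 2 : ℝ) : ℂ) - Complex.exp ((-(v * u ^ 2 / 2) : ℝ) : ℂ))
      =o[𝓝 0] fun u : ℝ => u ^ 2 := by
    have h3 : (fun u : ℝ => (v * u ^ 2 / 2) ^ 2) =o[𝓝 0] fun u : ℝ => u ^ 2 := by
      have h4 : Tendsto (fun u : ℝ => v ^ 2 / 4 * u ^ 2) (𝓝 0) (𝓝 0) :=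
        Continuous.tendsto' (by fun_prop) _ _ (by simp)
      have := ((Asymptotics.isLittleO_one_iff ℝ).2 h4).mul_isBigO
        (Asymptotics.isBigO_refl (fun u : ℝ => u ^ 2) (𝓝 0))
      simp only [one_mul] at this
      exact this.congr_left fun u => by ring
    refine Asymptotics.IsBigO.trans_isLittleO ?_ h3
    have h5 : ∀ᶠ u : ℝ in 𝓝 0, |-(v * u ^ 2 / 2)| ≤ 1 := by
      have : Tendsto (fun u : ℝ => |-(v * u ^ 2 / 2)|) (𝓝 0) (𝓝 0) :=
        Continuous.tendsto' (by fun_prop) _ _ (by simp)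
      exact this.eventually_le_const one_pos
    refine Asymptotics.IsBigO.of_bound 1 ?_
    filter_upwards [h5] with u hu
    have h6 := Real.abs_exp_sub_one_sub_id_le hu
    rw [← Complex.ofReal_exp, ← Complex.ofReal_sub, Complex.norm_real,
      Real.norm_of_nonneg (sq_nonneg (v * u ^ 2 / 2)), one_mul, Real.norm_eq_abs, abs_sub_comm]
    rw [neg_sq] at h6
    convert! h6 using 2
    ring
  exact (h1.add h2).congr_left fun u => by ring

theorem exists_charFunError_le (hint : MemLp id 2 μ) (hmean : ∫ x, x ∂μ = 0)
    (hvar : ∫ x, x ^ 2 ∂μ = v) {δ : ℝ} (hδ : 0 < δ) :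
    ∃ η > 0, ∀ u, u ^ 2 ≤ η → charFunError μ v u ≤ δ * u ^ 2 := by
  have h1 := (charFunError_isLittleO hint hmean hvar).bound hδ
  obtain ⟨η, hη, h2⟩ := Metric.eventually_nhds_iff.1 h1
  refine ⟨(η / 2) ^ 2, by positivity, fun u hu => ?_⟩
  have h3 := h2 (y := u) (by
    rw [Real.dist_eq, sub_zero]
    have := abs_le_of_sq_le_sq hu (by positivity)
    linarith)
  rwa [Real.norm_of_nonneg (charFunError_nonneg u), Real.norm_of_nonneg (sq_nonneg u)] at h3

theorem exists_forall_charFunError_le (hint : MemLp id 2 μ) (hmean : ∫ x, x ∂μ = 0)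
    (hvar : ∫ x, x ^ 2 ∂μ = v) :
    ∃ C, 0 ≤ C ∧ ∀ u, charFunError μ v u ≤ C * u ^ 2 := by
  obtain ⟨η, hη, h⟩ := exists_charFunError_le hint hmean hvar one_pos
  have hv : 0 ≤ v := hvar ▸ integral_nonneg fun x => sq_nonneg x
  refine ⟨1 + 2 / η, by positivity, fun u => ?_⟩
  rcases le_total (u ^ 2) η with hu | hu
  · have : 0 ≤ 2 / η * u ^ 2 := by positivity
    linarith [h u hu]
  · have h1 : 2 / η * η ≤ 2 / η * u ^ 2 := by gcongr
    rw [div_mul_cancel₀ _ hη.ne'] at h1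
    nlinarith [charFunError_le_two (μ := μ) hv u, sq_nonneg u]

/-- Along a sequence whose squares have convergent averages, the rescaled errors add up to a
vanishing quantity. -/
theorem tendsto_sum_charFunError (hint : MemLp id 2 μ) (hmean : ∫ x, x ∂μ = 0)
    (hvar : ∫ x, x ^ 2 ∂μ = v) {w : ℕ → ℝ} {l : ℝ}
    (hw : Tendsto (avg fun k => w k ^ 2) atTop (𝓝 l)) (t : ℝ) :
    Tendsto (fun n : ℕ => ∑ k ∈ Finset.range n, charFunError μ v (t / √n * w k)) atTop (𝓝 0) := by
  have hl : 0 ≤ l := ge_of_tendsto' hw fun n =>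
    div_nonneg (Finset.sum_nonneg fun _ _ => sq_nonneg _) (Nat.cast_nonneg _)
  rw [Metric.tendsto_atTop']
  intro r hr
  set δ := r / (2 * (t ^ 2 * (l + 1) + 1)) with hδ
  have hδ0 : 0 < δ := by positivity
  obtain ⟨η, hη, h⟩ := exists_charFunError_le hint hmean hvar hδ0
  have h1 : Tendsto (fun n : ℕ => t ^ 2 * (w n ^ 2 / n)) atTop (𝓝 (t ^ 2 * 0)) :=
    (tendsto_div_of_tendsto_avg hw).const_mul _
  rw [mul_zero] at h1
  obtain ⟨N, hN⟩ := eventually_atTop.1 (h1.eventually_le_const hη)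
  have h2 : ∀ᶠ n : ℕ in atTop, ∑ k ∈ Finset.range (N + 1), t ^ 2 * w k ^ 2 ≤ η * n :=
    (tendsto_natCast_atTop_atTop.const_mul_atTop hη).eventually_ge_atTop _
  have h3 : ∀ᶠ n in atTop, avg (fun k => w k ^ 2) n ≤ l + 1 :=
    hw.eventually_le_const (by linarith)
  obtain ⟨M, hM⟩ := eventually_atTop.1 ((h2.and h3).and (eventually_gt_atTop 0))
  refine ⟨M, fun n hn => ?_⟩
  obtain ⟨⟨h2, h3⟩, hn0⟩ := hM n hn.le
  have hn0 : (0 : ℝ) < n := by positivity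
  have hsq : ∀ k, (t / √n * w k) ^ 2 = t ^ 2 * w k ^ 2 / n := by
    intro k
    rw [mul_pow, div_pow, Real.sq_sqrt hn0.le]
    ring
  have h4 : ∀ k ∈ Finset.range n, charFunError μ v (t / √n * w k) ≤ δ * (t ^ 2 * w k ^ 2 / n) := by
    intro k hk
    rw [← hsq]
    apply h
    rw [hsq, div_le_iff₀ hn0]
    rcases le_or_gt k N with hkN | hkN
    · exact (Finset.single_le_sum (f := fun k => t ^ 2 * w k ^ 2)
        (fun _ _ => by positivity) (Finset.mem_range.2 (by omega))).trans h2
    · have h5 := hN k hkN.le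
      have hk0 : (0 : ℝ) < k := by exact_mod_cast (Nat.zero_le N).trans_lt hkN
      rw [← mul_div_assoc, div_le_iff₀ hk0] at h5
      have h6 : (k : ℝ) ≤ n := by exact_mod_cast (Finset.mem_range.1 hk).le
      exact h5.trans (mul_le_mul_of_nonneg_left h6 hη.le)
  have h5 := Finset.sum_le_sum h4
  rw [← Finset.mul_sum, ← Finset.sum_div, ← Finset.mul_sum, mul_div_assoc] at h5
  have h6 : δ * (t ^ 2 * avg (fun k => w k ^ 2) n) ≤ δ * (t ^ 2 * (l + 1)) := by gcongr
  have h7 : δ * (t ^ 2 * (l + 1)) < r := by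
    have : δ * (t ^ 2 * (l + 1)) ≤ δ * (t ^ 2 * (l + 1) + 1) := by gcongr; linarith
    have h8 : δ * (t ^ 2 * (l + 1) + 1) = r / 2 := by rw [hδ]; field_simp
    linarith
  rw [Real.dist_eq, sub_zero, abs_of_nonneg (Finset.sum_nonneg fun _ _ => charFunError_nonneg _)]
  exact h5.trans_lt (h6.trans_lt h7)

end CharFunError

/-- Averaging out a noise which is independent of the past. -/
theorem integral_mul_cexp_of_indep {Ω : Type*} {m mΩ : MeasurableSpace Ω} {P : Measure Ω}
    [IsProbabilityMeasure P] {μ : Measure ℝ} [IsProbabilityMeasure μ] (hm : m ≤ mΩ) {ξ : Ω → ℝ}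
    (hξ : Measurable ξ) (hlaw : P.map ξ = μ)
    (hindep : Indep (MeasurableSpace.comap ξ inferInstance) m P)
    {A : Ω → ℂ} (hA : Measurable[m] A) {C : ℝ} (hC : ∀ ω, ‖A ω‖ ≤ C) {w : Ω → ℝ}
    (hw : Measurable[m] w) :
    ∫ ω, A ω * Complex.exp ((ξ ω * w ω : ℝ) * Complex.I) ∂P = ∫ ω, A ω * charFun μ (w ω) ∂P := by
  have hAw : Measurable[m] fun ω => (A ω, w ω) := hA.prodMk hw
  have hAw' : Measurable fun ω => (A ω, w ω) := hAw.mono hm le_rfl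
  have hind : IndepFun (fun ω => (A ω, w ω)) ξ P :=
    (indep_of_indep_of_le_right hindep hAw.comap_le).symm
  have hmap := hind.map_prod_eq_prod_map_map hAw'.aemeasurable hξ.aemeasurable
  have hP1 : IsProbabilityMeasure (P.map fun ω => (A ω, w ω)) :=
    Measure.isProbabilityMeasure_map hAw'.aemeasurable
  have hF : Measurable fun p : (ℂ × ℝ) × ℝ =>
      p.1.1 * Complex.exp ((p.2 * p.1.2 : ℝ) * Complex.I) := by fun_prop
  have h1 : ∫ ω, A ω * Complex.exp ((ξ ω * w ω : ℝ) * Complex.I) ∂P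
      = ∫ p, p.1.1 * Complex.exp ((p.2 * p.1.2 : ℝ) * Complex.I)
        ∂(P.map fun ω => ((A ω, w ω), ξ ω)) := by
    rw [integral_map (hAw'.prodMk hξ).aemeasurable hF.aestronglyMeasurable]
  have hcf : Continuous (charFun μ) := continuous_charFun
  have h2 : ∫ ω, A ω * charFun μ (w ω) ∂P
      = ∫ p : ℂ × ℝ, p.1 * charFun μ p.2 ∂(P.map fun ω => (A ω, w ω)) := by
    rw [integral_map hAw'.aemeasurable]
    exact (Measurable.mul measurable_fst (hcf.measurable.comp measurable_snd)).aestronglyMeasurable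
  have hint : Integrable (fun p : (ℂ × ℝ) × ℝ =>
      p.1.1 * Complex.exp ((p.2 * p.1.2 : ℝ) * Complex.I))
      (P.map fun ω => ((A ω, w ω), ξ ω)) := by
    rw [integrable_map_measure hF.aestronglyMeasurable (hAw'.prodMk hξ).aemeasurable]
    refine Integrable.of_bound (hF.comp (hAw'.prodMk hξ)).aestronglyMeasurable C
      (ae_of_all _ fun ω => ?_)
    simp only [Function.comp, norm_mul, Complex.norm_exp_ofReal_mul_I, mul_one]
    exact hC ω
  rw [h1, h2]
  rw [hmap, hlaw] at hint ⊢
  rw [integral_prod _ hint]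
  refine integral_congr_ae (ae_of_all _ fun p => ?_)
  simp only
  rw [integral_const_mul, charFun_apply_real]
  congr 1
  refine integral_congr_ae (ae_of_all _ fun x => ?_)
  simp only
  congr 1
  push_cast
  ring

section Martingale

variable {Ω : Type*} {mΩ : MeasurableSpace Ω} {P : Measure Ω} [IsProbabilityMeasure P]
  {μ : Measure ℝ} [IsProbabilityMeasure μ] {v : ℝ}

/-- The exponential of a martingale transform, compensated by the conditional variance, has
expectation close to one, as long as the conditional variance is bounded. Adding one term to the
sum changes the expectation by the error of the Gaussian approximation of a single
characteristic function. -/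
theorem norm_integral_cexp_sub_one_le {ℱ : Filtration ℕ mΩ} {ξ w : ℕ → Ω → ℝ} (hv : 0 ≤ v)
    (hξ : ∀ k, Measurable[ℱ (k + 1)] (ξ k)) (hlaw : ∀ k, P.map (ξ k) = μ)
    (hindep : ∀ k, Indep (MeasurableSpace.comap (ξ k) inferInstance) (ℱ k) P)
    (hw : ∀ k, Measurable[ℱ k] (w k)) {K : ℝ} {n : ℕ}
    (hK : ∀ ω, ∑ k ∈ Finset.range n, w k ω ^ 2 ≤ K) :
    ‖∫ ω, Complex.exp ((∑ k ∈ Finset.range n, ξ k ω * w k ω : ℝ) * Complex.I)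
        * Complex.exp ((v / 2 * ∑ k ∈ Finset.range n, w k ω ^ 2 : ℝ) : ℂ) ∂P - 1‖
      ≤ Real.exp (v / 2 * K) * ∫ ω, ∑ k ∈ Finset.range n, charFunError μ v (w k ω) ∂P := by
  have hsum : ∀ m, Measurable[ℱ m] fun ω => ∑ k ∈ Finset.range m, ξ k ω * w k ω := by
    intro m
    refine Finset.measurable_fun_sum _ fun k hk => ?_
    have hk := Finset.mem_range.1 hk
    exact ((hξ k).mono (ℱ.mono hk) le_rfl).mul ((hw k).mono (ℱ.mono hk.le) le_rfl)
  have hsq : ∀ m l, m ≤ l + 1 →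
      Measurable[ℱ l] fun ω => ∑ k ∈ Finset.range m, w k ω ^ 2 := by
    intro m l hml
    refine Finset.measurable_fun_sum _ fun k hk => ?_
    have hk := Finset.mem_range.1 hk
    exact ((hw k).mono (ℱ.mono (by omega)) le_rfl).pow_const 2
  have herr : ∀ k, Integrable (fun ω => charFunError μ v (w k ω)) P := fun k =>
    Integrable.of_bound (measurable_charFunError.comp
      ((hw k).mono (ℱ.le k) le_rfl)).aestronglyMeasurable 2 (ae_of_all _ fun ω => by
        rw [Real.norm_of_nonneg (charFunError_nonneg _)]
        exact charFunError_le_two hv _)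
  have hbd : ∀ m ≤ n, ∀ ω, v / 2 * ∑ k ∈ Finset.range m, w k ω ^ 2 ≤ v / 2 * K := by
    intro m hm ω
    refine mul_le_mul_of_nonneg_left (le_trans ?_ (hK ω)) (by positivity)
    exact Finset.sum_le_sum_of_subset_of_nonneg (Finset.range_mono hm) fun _ _ _ => sq_nonneg _
  have key : ∀ m ≤ n, ‖∫ ω, Complex.exp ((∑ k ∈ Finset.range m, ξ k ω * w k ω : ℝ) * Complex.I)
        * Complex.exp ((v / 2 * ∑ k ∈ Finset.range m, w k ω ^ 2 : ℝ) : ℂ) ∂P - 1‖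
      ≤ Real.exp (v / 2 * K) * ∑ k ∈ Finset.range m, ∫ ω, charFunError μ v (w k ω) ∂P := by
    intro m
    induction m with
    | zero => intro _; simp
    | succ m ih =>
      intro hm
      have hwm : Measurable (w m) := (hw m).mono (ℱ.le m) le_rfl
      have hcf : Continuous (charFun μ) := continuous_charFun
      -- `A` leaves out the last noise factor but keeps its compensator, so it is known at time `m`
      set A : Ω → ℂ := fun ω => Complex.exp ((∑ k ∈ Finset.range m, ξ k ω * w k ω : ℝ) * Complex.I)
        * Complex.exp ((v / 2 * ∑ k ∈ Finset.range (m + 1), w k ω ^ 2 : ℝ) : ℂ) with hA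
      have hAm : Measurable[ℱ m] A := by
        have h1 := hsum m
        have h2 := hsq (m + 1) m le_rfl
        exact (Complex.measurable_exp.comp ((Complex.measurable_ofReal.comp h1).mul_const _)).mul
          (Complex.measurable_exp.comp (Complex.measurable_ofReal.comp (h2.const_mul _)))
      have hAm' : Measurable A := hAm.mono (ℱ.le m) le_rfl
      have hAb : ∀ ω, ‖A ω‖ ≤ Real.exp (v / 2 * K) := by
        intro ω
        rw [hA, norm_mul, Complex.norm_exp_ofReal_mul_I, one_mul, Complex.norm_exp_ofReal,
          Real.exp_le_exp]
        exact hbd (m + 1) hm ω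
      have h1 : ∀ ω, Complex.exp ((∑ k ∈ Finset.range (m + 1), ξ k ω * w k ω : ℝ) * Complex.I)
          * Complex.exp ((v / 2 * ∑ k ∈ Finset.range (m + 1), w k ω ^ 2 : ℝ) : ℂ)
          = A ω * Complex.exp ((ξ m ω * w m ω : ℝ) * Complex.I) := by
        intro ω
        rw [hA, Finset.sum_range_succ (fun k => ξ k ω * w k ω), Complex.ofReal_add, add_mul,
          Complex.exp_add]
        ring
      have h2 : ∀ ω, Complex.exp ((∑ k ∈ Finset.range m, ξ k ω * w k ω : ℝ) * Complex.I)
          * Complex.exp ((v / 2 * ∑ k ∈ Finset.range m, w k ω ^ 2 : ℝ) : ℂ)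
          = A ω * Complex.exp ((-(v * w m ω ^ 2 / 2) : ℝ) : ℂ) := by
        intro ω
        simp only [hA]
        rw [Finset.sum_range_succ (fun k => w k ω ^ 2), mul_assoc]
        congr 1
        rw [← Complex.exp_add, ← Complex.ofReal_add]
        congr 2
        ring
      have hint1 : Integrable (fun ω => A ω * charFun μ (w m ω)) P := by
        refine Integrable.of_bound (hAm'.mul (hcf.measurable.comp hwm)).aestronglyMeasurable
          (Real.exp (v / 2 * K)) (ae_of_all _ fun ω => ?_)
        rw [norm_mul]
        exact (mul_le_of_le_one_right (norm_nonneg _) (norm_charFun_le_one _)).trans (hAb ω)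
      have hint2 : Integrable (fun ω => A ω * Complex.exp ((-(v * w m ω ^ 2 / 2) : ℝ) : ℂ)) P := by
        refine Integrable.of_bound (by fun_prop) (Real.exp (v / 2 * K)) (ae_of_all _ fun ω => ?_)
        rw [norm_mul, Complex.norm_exp_ofReal]
        refine (mul_le_of_le_one_right (norm_nonneg _) ?_).trans (hAb ω)
        rw [Real.exp_le_one_iff]
        have : 0 ≤ v * w m ω ^ 2 / 2 := by positivity
        linarith
      have h3 : ‖(∫ ω, A ω * charFun μ (w m ω) ∂P)
          - ∫ ω, A ω * Complex.exp ((-(v * w m ω ^ 2 / 2) : ℝ) : ℂ) ∂P‖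
          ≤ Real.exp (v / 2 * K) * ∫ ω, charFunError μ v (w m ω) ∂P := by
        rw [← integral_sub hint1 hint2, ← integral_const_mul]
        refine norm_integral_le_of_norm_le ((herr m).const_mul _) (ae_of_all _ fun ω => ?_)
        rw [← mul_sub, norm_mul]
        exact mul_le_mul_of_nonneg_right (hAb ω) (norm_nonneg _)
      have h4 := ih (by omega)
      simp only [h2] at h4
      simp only [h1]
      rw [integral_mul_cexp_of_indep (ℱ.le m) ((hξ m).mono (ℱ.le _) le_rfl) (hlaw m) (hindep m)
        hAm hAb (hw m), Finset.sum_range_succ, mul_add]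
      refine le_trans ?_ (add_le_add h4 h3)
      rw [add_comm ‖_ - 1‖]
      refine le_trans (le_of_eq ?_) (norm_add_le _ _)
      congr 1
      ring
  rw [integral_finsetSum _ fun k _ => herr k]
  exact key n le_rfl

/-- A central limit theorem for the martingale transforms `∑ ξ_k W_k` of an i.i.d. centred noise:
`W_k` depends on the past only, and its empirical second moment converges almost surely. The
weights are truncated predictably, so that the compensator of the exponential stays bounded and
can be replaced by its limit under the expectation. -/
theorem tendstoInDistribution_martingaleTransform {ℱ : Filtration ℕ mΩ} {ξ W : ℕ → Ω → ℝ}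
    (hξ : ∀ k, Measurable[ℱ (k + 1)] (ξ k)) (hlaw : ∀ k, P.map (ξ k) = μ)
    (hindep : ∀ k, Indep (MeasurableSpace.comap (ξ k) inferInstance) (ℱ k) P)
    (hint : MemLp id 2 μ) (hmean : ∫ x, x ∂μ = 0) (hvar : ∫ x, x ^ 2 ∂μ = v)
    (hW : ∀ k, Measurable[ℱ k] (W k)) {l : ℝ}
    (hlim : ∀ᵐ ω ∂P, Tendsto (avg fun k => W k ω ^ 2) atTop (𝓝 l)) :
    TendstoInDistribution (fun (n : ℕ) ω => (√n)⁻¹ * ∑ k ∈ Finset.range n, ξ k ω * W k ω) atTop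
      (id : ℝ → ℝ) (fun _ => P) (gaussianReal 0 (v * l).toNNReal) := by
  have hv : 0 ≤ v := hvar ▸ integral_nonneg fun x => sq_nonneg x
  have hl : 0 ≤ l := by
    obtain ⟨ω, hω⟩ := hlim.exists
    exact ge_of_tendsto' hω fun n =>
      div_nonneg (Finset.sum_nonneg fun _ _ => sq_nonneg _) (Nat.cast_nonneg _)
  have hξm : ∀ k, Measurable (ξ k) := fun k => (hξ k).mono (ℱ.le _) le_rfl
  have hWm : ∀ k, Measurable (W k) := fun k => (hW k).mono (ℱ.le _) le_rfl
  have hmeas : ∀ n : ℕ, Measurable fun ω => (√n)⁻¹ * ∑ k ∈ Finset.range n, ξ k ω * W k ω :=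
    fun n => (Finset.measurable_fun_sum _ fun k _ => (hξm k).mul (hWm k)).const_mul _
  refine ⟨fun n => (hmeas n).aemeasurable, aemeasurable_id,
    ProbabilityMeasure.tendsto_iff_tendsto_charFun.2 fun t => ?_⟩
  simp only [ProbabilityMeasure.coe_mk, Measure.map_id]
  -- the predictable truncation of the rescaled weights
  set L := l + 1 with hL
  set w : ℕ → ℕ → Ω → ℝ := fun n k ω =>
    if ∑ j ∈ Finset.range (k + 1), W j ω ^ 2 ≤ L * n then t / √n * W k ω else 0 with hw
  have hwF : ∀ n k, Measurable[ℱ k] (w n k) := by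
    intro n k
    have h1 : Measurable[ℱ k] fun ω => ∑ j ∈ Finset.range (k + 1), W j ω ^ 2 := by
      refine Finset.measurable_fun_sum _ fun j hj => ?_
      have hj := Finset.mem_range.1 hj
      exact ((hW j).mono (ℱ.mono (by omega)) le_rfl).pow_const 2
    exact Measurable.ite (measurableSet_le h1 measurable_const) ((hW k).const_mul _)
      measurable_const
  have hwm : ∀ n k, Measurable (w n k) := fun n k => (hwF n k).mono (ℱ.le k) le_rfl
  have hwK : ∀ n ω, ∑ k ∈ Finset.range n, w n k ω ^ 2 ≤ t ^ 2 * L := by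
    intro n ω
    rcases Nat.eq_zero_or_pos n with rfl | hn
    · simp only [Finset.range_zero, Finset.sum_empty]; positivity
    have hn' : (0 : ℝ) < n := by positivity
    have h1 := sum_truncated_le (a := fun k => W k ω ^ 2) (fun k => sq_nonneg _)
      (L := L * n) (by positivity) n
    have h2 : ∑ k ∈ Finset.range n, w n k ω ^ 2 = t ^ 2 / n * ∑ k ∈ Finset.range n,
        (if ∑ j ∈ Finset.range (k + 1), W j ω ^ 2 ≤ L * n then W k ω ^ 2 else 0) := by
      rw [Finset.mul_sum]
      refine Finset.sum_congr rfl fun k _ => ?_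
      simp only [hw]
      split_ifs
      · rw [mul_pow, div_pow, Real.sq_sqrt hn'.le]
      · simp
    rw [h2]
    refine (mul_le_mul_of_nonneg_left h1 (by positivity)).trans (le_of_eq ?_)
    field_simp
  -- almost surely, the truncation is eventually not felt
  have hw_eq : ∀ᵐ ω ∂P, ∀ᶠ n : ℕ in atTop, ∀ k ∈ Finset.range n, w n k ω = t / √n * W k ω := by
    filter_upwards [hlim] with ω hω
    filter_upwards [hω.eventually_le_const (show l < L by linarith), eventually_gt_atTop 0]
      with n hn hn0 k hk
    have hn0 : (0 : ℝ) < n := by positivity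
    rw [avg, div_le_iff₀ hn0] at hn
    refine if_pos (le_trans ?_ hn)
    exact Finset.sum_le_sum_of_subset_of_nonneg (Finset.range_mono (Finset.mem_range.1 hk))
      fun _ _ _ => sq_nonneg _
  -- `exp (-κ)` is the limit of the characteristic functions, and `U` the compensated exponential
  set κ := v * l * t ^ 2 / 2 with hκ
  set B := Real.exp (v / 2 * (t ^ 2 * L)) with hB
  set U : ℕ → Ω → ℂ := fun n ω =>
    Complex.exp ((∑ k ∈ Finset.range n, ξ k ω * w n k ω : ℝ) * Complex.I)
      * Complex.exp ((v / 2 * ∑ k ∈ Finset.range n, w n k ω ^ 2 : ℝ) : ℂ) with hU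
  have hU_meas : ∀ n, Measurable (U n) := by
    intro n
    have h1 : Measurable fun ω => ∑ k ∈ Finset.range n, ξ k ω * w n k ω :=
      Finset.measurable_fun_sum _ fun k _ => (hξm k).mul (hwm n k)
    have h2 : Measurable fun ω => ∑ k ∈ Finset.range n, w n k ω ^ 2 :=
      Finset.measurable_fun_sum _ fun k _ => (hwm n k).pow_const 2
    fun_prop
  have hU_bd : ∀ n ω, ‖U n ω‖ ≤ B := by
    intro n ω
    rw [hU, norm_mul, Complex.norm_exp_ofReal_mul_I, one_mul, Complex.norm_exp_ofReal,
      Real.exp_le_exp]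
    exact mul_le_mul_of_nonneg_left (hwK n ω) (by positivity)
  have hU_lim : Tendsto (fun n => ∫ ω, U n ω ∂P) atTop (𝓝 1) := by
    have h1 : Tendsto (fun n : ℕ => ∫ ω, ∑ k ∈ Finset.range n, charFunError μ v (w n k ω) ∂P) atTop
        (𝓝 (∫ _, (0 : ℝ) ∂P)) := by
      obtain ⟨C, hC0, hC⟩ := exists_forall_charFunError_le hint hmean hvar
      refine tendsto_integral_of_dominated_convergence (fun _ => C * (t ^ 2 * L))
        (fun n => ?_) (integrable_const _) (fun n => ae_of_all _ fun ω => ?_) ?_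
      · exact (Finset.measurable_fun_sum _ fun k _ =>
          measurable_charFunError.comp (hwm n k)).aestronglyMeasurable
      · rw [Real.norm_of_nonneg (Finset.sum_nonneg fun _ _ => charFunError_nonneg _)]
        refine (Finset.sum_le_sum fun k _ => hC _).trans ?_
        rw [← Finset.mul_sum]
        exact mul_le_mul_of_nonneg_left (hwK n ω) hC0
      · filter_upwards [hlim, hw_eq] with ω h1 h2
        refine (tendsto_sum_charFunError hint hmean hvar h1 t).congr' ?_
        filter_upwards [h2] with n hn
        exact Finset.sum_congr rfl fun k hk => by rw [hn k hk]
    have h2 := h1.const_mul B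
    rw [integral_zero, mul_zero] at h2
    rw [tendsto_iff_norm_sub_tendsto_zero]
    exact squeeze_zero (fun n => norm_nonneg _)
      (fun n => norm_integral_cexp_sub_one_le hv hξ hlaw hindep (hwF n) (hwK n)) h2
  have hdiff : Tendsto (fun n : ℕ => ∫ ω, (Complex.exp
      ((t * ((√n)⁻¹ * ∑ k ∈ Finset.range n, ξ k ω * W k ω) : ℝ) * Complex.I)
      - Complex.exp ((-κ : ℝ) : ℂ) * U n ω) ∂P) atTop (𝓝 (∫ _, (0 : ℂ) ∂P)) := by
    refine tendsto_integral_of_dominated_convergence (fun _ => 1 + Real.exp (-κ) * B)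
      (fun n => ?_) (integrable_const _) (fun n => ae_of_all _ fun ω => ?_) ?_
    · have h1 := hmeas n
      have h2 := hU_meas n
      exact (by fun_prop : Measurable _).aestronglyMeasurable
    · refine (norm_sub_le _ _).trans ?_
      rw [Complex.norm_exp_ofReal_mul_I, norm_mul, Complex.norm_exp_ofReal]
      exact add_le_add_right (mul_le_mul_of_nonneg_left (hU_bd n ω) (Real.exp_nonneg _)) _
    · filter_upwards [hlim, hw_eq] with ω h1 h2
      have h3 : Tendsto (fun n => 1 - Real.exp (-κ) *
          Real.exp (v / 2 * (t ^ 2 * avg (fun k => W k ω ^ 2) n))) atTop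
          (𝓝 (1 - Real.exp (-κ) * Real.exp (v / 2 * (t ^ 2 * l)))) :=
        tendsto_const_nhds.sub (((Real.continuous_exp.tendsto _).comp
          ((h1.const_mul _).const_mul _)).const_mul _)
      have h4 : 1 - Real.exp (-κ) * Real.exp (v / 2 * (t ^ 2 * l)) = 0 := by
        rw [← Real.exp_add, show -κ + v / 2 * (t ^ 2 * l) = 0 by rw [hκ]; ring, Real.exp_zero,
          sub_self]
      rw [h4] at h3
      refine squeeze_zero_norm' ?_ (tendsto_zero_iff_abs_tendsto_zero _ |>.1 h3)
      filter_upwards [h2, eventually_gt_atTop 0] with n hn hn0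
      have hn0 : (0 : ℝ) < n := by positivity
      have h5 : ∑ k ∈ Finset.range n, ξ k ω * w n k ω
          = t * ((√n)⁻¹ * ∑ k ∈ Finset.range n, ξ k ω * W k ω) := by
        rw [← mul_assoc, Finset.mul_sum]
        refine Finset.sum_congr rfl fun k hk => ?_
        rw [hn k hk]
        ring
      have h6 : ∑ k ∈ Finset.range n, w n k ω ^ 2 = t ^ 2 * avg (fun k => W k ω ^ 2) n := by
        rw [avg, ← mul_div_assoc, Finset.mul_sum, Finset.sum_div]
        refine Finset.sum_congr rfl fun k hk => ?_
        rw [hn k hk, mul_pow, div_pow, Real.sq_sqrt hn0.le]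
        ring
      simp only [hU, h5, h6, Function.comp]
      have h7 : ∀ E a b : ℂ, E - a * (E * b) = E * (1 - a * b) := fun E a b => by ring
      rw [h7, norm_mul, Complex.norm_exp_ofReal_mul_I, one_mul,
        ← Complex.ofReal_exp, ← Complex.ofReal_exp, ← Complex.ofReal_mul, ← Complex.ofReal_one,
        ← Complex.ofReal_sub, Complex.norm_real, Real.norm_eq_abs]
  rw [integral_zero] at hdiff
  have hfin := hdiff.add (hU_lim.const_mul (Complex.exp ((-κ : ℝ) : ℂ)))
  rw [zero_add, mul_one] at hfin
  have hgauss : charFun (gaussianReal 0 (v * l).toNNReal) t = Complex.exp ((-κ : ℝ) : ℂ) := by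
    rw [charFun_gaussianReal, Real.coe_toNNReal _ (by positivity)]
    congr 1
    rw [hκ]
    push_cast
    ring
  rw [hgauss]
  refine hfin.congr fun n => ?_
  have hint1 : Integrable (fun ω => Complex.exp
      ((t * ((√n)⁻¹ * ∑ k ∈ Finset.range n, ξ k ω * W k ω) : ℝ) * Complex.I)) P := by
    have h1 := hmeas n
    refine Integrable.of_bound (by fun_prop : Measurable _).aestronglyMeasurable 1
      (ae_of_all _ fun ω => ?_)
    rw [Complex.norm_exp_ofReal_mul_I]
  have hint2 : Integrable (fun ω => Complex.exp ((-κ : ℝ) : ℂ) * U n ω) P :=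
    (Integrable.of_bound (hU_meas n).aestronglyMeasurable B
      (ae_of_all _ fun ω => hU_bd n ω)).const_mul _
  rw [integral_sub hint1 hint2, integral_const_mul, sub_add_cancel, charFun_apply_real,
    integral_map (hmeas n).aemeasurable (by fun_prop)]
  refine integral_congr_ae (ae_of_all _ fun ω => ?_)
  simp only
  congr 1
  push_cast
  ring

end Martingale

/-! ### Asymptotic normality under the null hypothesis -/

/-- The autoregression with parameter `θ` and innovations `u 0, u 1, …`, started at zero. -/
def autoregression (θ : ℝ) (u : ℕ → ℝ) : ℕ → ℝ
  | 0 => 0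
  | n + 1 => θ * autoregression θ u n + u n

/-- The predictable weights `y_{k-1} - θ y_k`, with the convention `0` for `k = 0`: the
leading term of the Durbin-Watson statistic is the martingale transform of the noise by them. -/
def lagWeight (θ : ℝ) (y : ℕ → ℝ) : ℕ → ℝ
  | 0 => 0
  | k + 1 => y k - θ * y (k + 1)

/-- A signed square root of the test statistic. Its square is the test statistic even when
`thetaHat x n = 0`, since both are then zero. -/
noncomputable def dwRoot (x : ℕ → ℝ) (n : ℕ) : ℝ :=
  √n * ((durbinWatson x n - 2) / (2 * thetaHat x n))

theorem dwRoot_sq (x : ℕ → ℝ) (n : ℕ) : dwRoot x n ^ 2 = dwTestStatistic x n := by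
  rw [dwRoot, dwTestStatistic, mul_pow, div_pow, mul_pow, Real.sq_sqrt (Nat.cast_nonneg n)]
  ring

/-- The inverse of the empirical residual variance, which normalizes the test statistic. -/
noncomputable def residualPrecision (x : ℕ → ℝ) (n : ℕ) : ℝ :=
  n / ∑ k ∈ Finset.range (n + 1), lsResidual x n k ^ 2

/-- The difference between `θ` and the ratio of `∑ x_k x_{k-1}` over `1 ≤ k < n` to
`∑ x_{k-1} ^ 2` over `1 ≤ k ≤ n`. -/
noncomputable def lagError (θ : ℝ) (x : ℕ → ℝ) (n : ℕ) : ℝ :=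
  θ - (∑ k ∈ Finset.range (n - 1), x (k + 1) * x k) / ∑ k ∈ Finset.range n, x k ^ 2

theorem tendsto_avg_of_succ {f : ℕ → ℝ} {l : ℝ}
    (h : Tendsto (avg fun k => f (k + 1)) atTop (𝓝 l)) : Tendsto (avg f) atTop (𝓝 l) := by
  rw [← tendsto_add_atTop_iff_nat 1]
  have h1 := (h.add (tendsto_const_div_natCast (f 0))).mul
    (tendsto_natCast_succ_div.inv₀ one_ne_zero)
  rw [add_zero, inv_one, mul_one] at h1
  refine h1.congr' ?_
  filter_upwards [eventually_gt_atTop 0] with n hn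
  have : (n : ℝ) ≠ 0 := by positivity
  have h3 : ((n + 1 : ℕ) : ℝ) ≠ 0 := by positivity
  simp only [avg, Finset.sum_range_succ' f n]
  field_simp

section Path

variable {θ σ : ℝ} {x y v : ℕ → ℝ}

/-- A noise is the autoregression with parameter zero driven by itself, so that the results for a
general `ρ` specialize to `ρ = 0`. -/
theorem eq_zero_mul_add (v : ℕ → ℝ) (n : ℕ) : v (n + 1) = 0 * v n + v (n + 1) := by ring

theorem thetaLim_zero : thetaLim θ 0 = θ := by simp [thetaLim]

theorem one_sub_sq_mul_arVariance (hθ : |θ| < 1) : (1 - θ ^ 2) * arVariance θ 0 σ = σ ^ 2 := by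
  have h2 : 1 - θ ^ 2 ≠ 0 := by have := (sq_lt_one_iff_abs_lt_one θ).2 hθ; linarith
  simp only [arVariance]
  field_simp
  ring

theorem IsNoisePath.tendsto_avg_lagWeight_sq (hv : IsNoisePath σ v) (hθ : |θ| < 1)
    (hy : ∀ n, y (n + 1) = θ * y n + v (n + 1)) :
    Tendsto (avg fun k => lagWeight θ y k ^ 2) atTop (𝓝 (σ ^ 2)) := by
  obtain ⟨h1, h2⟩ := hv.tendsto_avg_sq_and_mul hθ (by simp) hy (eq_zero_mul_add v)
  rw [thetaLim_zero] at h2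
  have h3 := (h1.add (h2.const_mul (-2 * θ))).add ((tendsto_avg_succ h1).const_mul (θ ^ 2))
  rw [show arVariance θ 0 σ + -2 * θ * (θ * arVariance θ 0 σ) + θ ^ 2 * arVariance θ 0 σ
    = (1 - θ ^ 2) * arVariance θ 0 σ by ring, one_sub_sq_mul_arVariance hθ] at h3
  refine tendsto_avg_of_succ (h3.congr fun n => ?_)
  rw [← avg_const_mul, ← avg_const_mul, ← avg_add, ← avg_add]
  congr 1
  funext k
  simp only [lagWeight]
  ring

theorem IsNoisePath.tendsto_residualPrecision (hv : IsNoisePath σ v) (hθ : |θ| < 1) (hσ : 0 < σ)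
    (hx : ∀ n, x (n + 1) = θ * x n + v (n + 1)) :
    Tendsto (residualPrecision x) atTop (𝓝 ((σ ^ 2)⁻¹)) := by
  have h1 := hv.tendsto_sum_lsResidual_sq hθ (by simp) hσ hx (eq_zero_mul_add v)
  rw [thetaLim_zero, one_sub_sq_mul_arVariance hθ] at h1
  rw [← tendsto_add_atTop_iff_nat 1]
  have h2 := tendsto_natCast_succ_div.div h1 (by positivity)
  rw [one_div] at h2
  refine h2.congr' ?_
  filter_upwards [eventually_gt_atTop 0] with n hn
  have : (n : ℝ) ≠ 0 := by positivity
  simp only [Pi.div_apply, residualPrecision]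
  rw [div_div_div_cancel_right₀ this]

theorem IsNoisePath.tendsto_lagError (hv : IsNoisePath σ v) (hθ : |θ| < 1) (hσ : 0 < σ)
    (hx : ∀ n, x (n + 1) = θ * x n + v (n + 1)) :
    Tendsto (lagError θ x) atTop (𝓝 0) := by
  obtain ⟨h1, h2⟩ := hv.tendsto_avg_sq_and_mul hθ (by simp) hx (eq_zero_mul_add v)
  have hs := (arVariance_pos hθ (by simp : |(0 : ℝ)| < 1) hσ).ne'
  rw [thetaLim_zero] at h2
  rw [← tendsto_add_atTop_iff_nat 1]
  have h3 := (h1.comp (tendsto_add_atTop_nat 1)).mul tendsto_natCast_succ_div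
  rw [mul_one] at h3
  have h4 := (tendsto_const_nhds (x := θ)).sub (h2.div h3 hs)
  rw [mul_div_cancel_right₀ _ hs, sub_self] at h4
  refine h4.congr' ?_
  filter_upwards [eventually_gt_atTop 0] with n hn
  have : (n : ℝ) ≠ 0 := by positivity
  have h5 : ((n + 1 : ℕ) : ℝ) ≠ 0 := by positivity
  simp only [Pi.div_apply, avg, lagError, Function.comp, Nat.add_sub_cancel]
  rw [div_mul_div_cancel₀ h5, div_div_div_cancel_right₀ this]

/-- A noise of moderate growth is summable against geometric weights, so that the initial value of
the process does not matter at the scale `√n`. -/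
theorem summable_mul_pow (hθ : |θ| < 1)
    (hv : Tendsto (fun n : ℕ => v n / √(√(n + 1))) atTop (𝓝 0)) (i : ℕ) :
    Summable fun k => v (k + i) * θ ^ k := by
  obtain ⟨C, hC⟩ := hv.abs.bddAbove_range
  have hC' : ∀ n : ℕ, |v n| ≤ C * (n + 1) := by
    intro n
    have h1 : |v n / √(√((n : ℝ) + 1))| ≤ C := hC ⟨n, rfl⟩
    have h2 : (0 : ℝ) < √(√((n : ℝ) + 1)) := by positivity
    rw [abs_div, abs_of_pos h2, div_le_iff₀ h2] at h1
    have h3 : (0 : ℝ) ≤ C := by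
      by_contra h
      have := mul_neg_of_neg_of_pos (not_le.1 h) h2
      linarith [abs_nonneg (v n)]
    have hle : ∀ z : ℝ, 1 ≤ z → 1 ≤ √z ∧ √z ≤ z := fun z hz =>
      ⟨Real.one_le_sqrt.2 hz, by rw [Real.sqrt_le_left (by linarith)]; nlinarith⟩
    have h4 := hle (n + 1) (by linarith [Nat.cast_nonneg (α := ℝ) n])
    exact h1.trans (mul_le_mul_of_nonneg_left ((hle _ h4.1).2.trans h4.2) h3)
  have hθ' : ‖|θ|‖ < 1 := by simpa using hθ
  have h1 : Summable fun k : ℕ => C * ((k : ℝ) ^ 1 * |θ| ^ k) + C * (i + 1) * |θ| ^ k :=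
    ((summable_pow_mul_geometric_of_norm_lt_one 1 hθ').mul_left C).add
      ((summable_geometric_of_norm_lt_one hθ').mul_left _)
  refine Summable.of_norm_bounded h1 fun k => ?_
  rw [norm_mul, norm_pow, Real.norm_eq_abs, Real.norm_eq_abs]
  refine (mul_le_mul_of_nonneg_right (hC' (k + i)) (by positivity)).trans (le_of_eq ?_)
  push_cast
  ring

/-- The exact decomposition of the leading term of `durbinWatson_sub_two` into a martingale
transform of the noise, a correction by the least squares martingale and the contribution of the
initial value. -/
theorem lag_two_sub_eq (hx : ∀ n, x (n + 1) = θ * x n + v (n + 1))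
    (hy : ∀ n, y (n + 1) = θ * y n + v (n + 1)) (hy0 : y 0 = 0) {n : ℕ}
    (hS : ∑ k ∈ Finset.range (n + 1), x k ^ 2 ≠ 0) :
    ∑ k ∈ Finset.range n, x (k + 2) * x k
        - thetaHat x (n + 1) * ∑ k ∈ Finset.range n, x (k + 1) * x k
      = ∑ k ∈ Finset.range (n + 1), v (k + 1) * lagWeight θ y k
        + lagError θ x (n + 1) * ∑ k ∈ Finset.range (n + 1), v (k + 1) * y k
        + (x 0 * (∑ k ∈ Finset.range n, v (k + 2) * θ ^ k
            - θ * ∑ k ∈ Finset.range (n + 1), v (k + 1) * θ ^ k)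
          + lagError θ x (n + 1) * (x 0 * ∑ k ∈ Finset.range (n + 1), v (k + 1) * θ ^ k)) := by
  have hxy : ∀ k, x k = y k + θ ^ k * x 0 := by
    intro k
    induction k with
    | zero => simp [hy0]
    | succ k ih => rw [hx, hy, ih]; ring
  set S := ∑ k ∈ Finset.range (n + 1), x k ^ 2 with hSdef
  set p := ∑ k ∈ Finset.range n, x (k + 1) * x k with hp
  set E := ∑ k ∈ Finset.range (n + 1), v (k + 1) * θ ^ k with hE
  have hM : ∑ k ∈ Finset.range (n + 1), v (k + 1) * x k
      = ∑ k ∈ Finset.range (n + 1), v (k + 1) * y k + x 0 * E := by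
    rw [hE, Finset.mul_sum, ← Finset.sum_add_distrib]
    refine Finset.sum_congr rfl fun k _ => ?_
    rw [hxy k]
    ring
  have hth : thetaHat x (n + 1) * S = θ * S + ∑ k ∈ Finset.range (n + 1), v (k + 1) * x k := by
    rw [thetaHat, div_mul_cancel₀ _ hS, hSdef, Finset.mul_sum, ← Finset.sum_add_distrib]
    refine Finset.sum_congr rfl fun k _ => ?_
    rw [hx k]
    ring
  have hC : ∑ k ∈ Finset.range n, x (k + 2) * x k
      = θ * p + ∑ k ∈ Finset.range n, v (k + 2) * y k
        + x 0 * ∑ k ∈ Finset.range n, v (k + 2) * θ ^ k := by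
    rw [hp, Finset.mul_sum, Finset.mul_sum, ← Finset.sum_add_distrib, ← Finset.sum_add_distrib]
    refine Finset.sum_congr rfl fun k _ => ?_
    rw [hx (k + 1), mul_comm (v (k + 1 + 1)) , add_mul]
    rw [hxy k]
    ring
  have hZ : ∑ k ∈ Finset.range (n + 1), v (k + 1) * lagWeight θ y k
      = ∑ k ∈ Finset.range n, v (k + 2) * y k
        - θ * ∑ k ∈ Finset.range (n + 1), v (k + 1) * y k := by
    rw [Finset.sum_range_succ', Finset.sum_range_succ' (fun k => v (k + 1) * y k), hy0,
      mul_zero, add_zero, Finset.mul_sum, ← Finset.sum_sub_distrib]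
    simp only [lagWeight, mul_zero, add_zero]
    refine Finset.sum_congr rfl fun k _ => ?_
    ring
  have hl : lagError θ x (n + 1) = θ - p / S := by
    rw [lagError, Nat.add_sub_cancel]
  have hth' : thetaHat x (n + 1)
      = θ + (∑ k ∈ Finset.range (n + 1), v (k + 1) * y k + x 0 * E) / S := by
    rw [← hM]
    field_simp
    linarith
  rw [hC, hZ, hl, hth']
  ring

/-- Under the null hypothesis, the signed root of the test statistic is pathwise close to a
martingale transform of the noise, up to a random factor and a correction whose coefficient
vanishes. -/
theorem IsNoisePath.tendsto_dwRoot_sub (hv : IsNoisePath σ v) (hθ : |θ| < 1) (hσ : 0 < σ)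
    (hθ0 : θ ≠ 0) (hx : ∀ n, x (n + 1) = θ * x n + v (n + 1))
    (hy : ∀ n, y (n + 1) = θ * y n + v (n + 1)) (hy0 : y 0 = 0) :
    Tendsto (fun n : ℕ => dwRoot x n
      - (√n)⁻¹ * (∑ k ∈ Finset.range n, v (k + 1) * lagWeight θ y k) * residualPrecision x n
      - (√n)⁻¹ * (∑ k ∈ Finset.range n, v (k + 1) * y k)
        * (lagError θ x n * residualPrecision x n)) atTop (𝓝 0) := by
  rw [← tendsto_add_atTop_iff_nat 1]
  have ha := (hv.tendsto_residualPrecision hθ hσ hx).comp (tendsto_add_atTop_nat 1)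
  have hl := (hv.tendsto_lagError hθ hσ hx).comp (tendsto_add_atTop_nat 1)
  have ht := (hv.tendsto_thetaHat hθ (by simp) hσ hx (eq_zero_mul_add v)).comp
    (tendsto_add_atTop_nat 1)
  rw [thetaLim_zero] at ht
  have hg := hv.growth_autoregression₂ hθ (by simp) hx (eq_zero_mul_add v)
  have hsqrt : Tendsto (fun n : ℕ => (√((n + 1 : ℕ) : ℝ))⁻¹) atTop (𝓝 0) :=
    (tendsto_inv_atTop_zero.comp (Real.tendsto_sqrt_atTop.comp tendsto_natCast_atTop_atTop)).comp
      (tendsto_add_atTop_nat 1)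
  have hE1 := (summable_mul_pow hθ hv.growth 2).hasSum.tendsto_sum_nat
  have hE2 := (summable_mul_pow hθ hv.growth 1).hasSum.tendsto_sum_nat.comp
    (tendsto_add_atTop_nat 1)
  have hinit := (ha.mul hsqrt).mul
    (((hE1.sub (hE2.const_mul θ)).const_mul (x 0)).add (hl.mul (hE2.const_mul (x 0))))
  rw [mul_zero, zero_mul] at hinit
  -- the boundary terms: the squared process is `o(√n)`
  have hb0 : Tendsto (fun n : ℕ => x n ^ 2 / √((n + 1 : ℕ) : ℝ)) atTop (𝓝 0) := by
    simpa only [Nat.cast_add, Nat.cast_one] using tendsto_sq_div_sqrt hg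
  have hb1 : Tendsto (fun n : ℕ => x (n + 1) ^ 2 / √((n + 1 : ℕ) : ℝ)) atTop (𝓝 0) := by
    have h1 := ((tendsto_sq_div_sqrt hg).comp (tendsto_add_atTop_nat 1)).mul_const 2
    rw [zero_mul] at h1
    refine squeeze_zero (fun n => by positivity) (fun n => ?_) h1
    have h2 : (0 : ℝ) < √((n + 1 : ℕ) : ℝ) := by positivity
    have h3 : (0 : ℝ) < √(((n + 1 : ℕ) : ℝ) + 1) := by positivity
    have h4 : √(((n + 1 : ℕ) : ℝ) + 1) ≤ 2 * √((n + 1 : ℕ) : ℝ) := by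
      rw [Real.sqrt_le_left (by positivity), mul_pow, Real.sq_sqrt (by positivity)]
      push_cast
      linarith [Nat.cast_nonneg (α := ℝ) n]
    simp only [Function.comp]
    rw [div_mul_eq_mul_div, div_le_div_iff₀ h2 h3]
    nlinarith [sq_nonneg (x (n + 1))]
  have hbd := (ha.div (ht.const_mul 2) (by positivity)).mul
    (((hsqrt.const_mul (x 0 ^ 2)).add (hb1.const_mul 2)).add ((ht.pow 2).mul (hb0.const_mul 2)))
  simp only [mul_zero, add_zero] at hbd
  have hbd' : Tendsto (fun n : ℕ => (residualPrecision x (n + 1) / (2 * thetaHat x (n + 1)))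
      * ((x 0 ^ 2 + (x (n + 1) - thetaHat x (n + 1) * x n) ^ 2) / √((n + 1 : ℕ) : ℝ))) atTop
      (𝓝 0) := by
    refine squeeze_zero_norm (fun n => ?_) (tendsto_zero_iff_abs_tendsto_zero _ |>.1 hbd)
    simp only [Function.comp, Pi.div_apply, Real.norm_eq_abs]
    rw [abs_mul, abs_mul]
    refine mul_le_mul_of_nonneg_left ?_ (abs_nonneg _)
    refine abs_le_abs_of_nonneg (by positivity) ?_
    rw [← mul_div_assoc, ← mul_div_assoc, ← mul_div_assoc, ← div_eq_mul_inv, ← add_div, ← add_div]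
    refine div_le_div_of_nonneg_right ?_ (by positivity)
    nlinarith [sq_nonneg (x (n + 1) + thetaHat x (n + 1) * x n)]
  have hfin := hinit.sub hbd'
  rw [sub_zero] at hfin
  refine hfin.congr' ?_
  have hJ := hv.tendsto_sum_lsResidual_sq hθ (by simp) hσ hx (eq_zero_mul_add v)
  rw [thetaLim_zero, one_sub_sq_mul_arVariance hθ] at hJ
  filter_upwards [hv.eventually_sum_sq_ne_zero hθ (by simp) hσ hx (eq_zero_mul_add v),
    hJ.eventually_ne (by positivity), ht.eventually_ne hθ0] with n hn hJn htn
  have hJn' : ∑ k ∈ Finset.range (n + 2), lsResidual x (n + 1) k ^ 2 ≠ 0 :=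
    fun h => hJn (by rw [h, zero_div])
  simp only [Function.comp] at htn ⊢
  have h1 := lag_two_sub_eq hx hy hy0 hn
  have h2 := durbinWatson_sub_two hn hJn'
  have hr0 : √((n + 1 : ℕ) : ℝ) ≠ 0 := by positivity
  have hr : ((n + 1 : ℕ) : ℝ) = √((n + 1 : ℕ) : ℝ) ^ 2 := (Real.sq_sqrt (Nat.cast_nonneg _)).symm
  have hp : residualPrecision x (n + 1) = √((n + 1 : ℕ) : ℝ) ^ 2
      / ∑ k ∈ Finset.range (n + 2), lsResidual x (n + 1) k ^ 2 := by rw [← hr]; rfl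
  rw [dwRoot, h2, h1, hp]
  generalize √((n + 1 : ℕ) : ℝ) = r at hr0
  generalize ∑ k ∈ Finset.range (n + 2), lsResidual x (n + 1) k ^ 2 = J at hJn'
  generalize thetaHat x (n + 1) = τ at htn
  generalize ∑ k ∈ Finset.range (n + 1), v (k + 1) * lagWeight θ y k = Z
  generalize ∑ k ∈ Finset.range (n + 1), v (k + 1) * y k = Q
  field_simp
  ring

end Path

section Distribution

variable {Ω : Type*} [MeasurableSpace Ω] {P : Measure Ω}

theorem tendstoInMeasure_of_tendstoInDistribution_zero [IsProbabilityMeasure P]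
    {Ω' : Type*} [MeasurableSpace Ω']
    {P' : Measure Ω'} [IsProbabilityMeasure P'] {F : ℕ → Ω → ℝ}
    (h : TendstoInDistribution F atTop (fun _ : Ω' => (0 : ℝ)) (fun _ => P) P') :
    TendstoInMeasure P F atTop fun _ => 0 := by
  rw [tendstoInMeasure_iff_norm]
  intro r hr
  have hcl : IsClosed {z : ℝ | r ≤ ‖z‖} := isClosed_le continuous_const continuous_norm
  have h1 := ProbabilityMeasure.limsup_measure_closed_le_of_tendsto h.tendsto hcl
  simp only [ProbabilityMeasure.coe_mk] at h1
  rw [Measure.map_const, Measure.smul_apply, Measure.dirac_apply' _ hcl.measurableSet,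
    Set.indicator_of_notMem (by simpa using hr), smul_zero] at h1
  refine tendsto_of_le_liminf_of_limsup_le bot_le ?_
  refine le_trans (le_of_eq ?_) h1
  congr 1
  funext n
  rw [Measure.map_apply_of_aemeasurable (h.forall_aemeasurable n) hcl.measurableSet]
  simp

theorem MeasureTheory.TendstoInDistribution.of_map_eq [IsProbabilityMeasure P]
    {Ω' Ω'' : Type*} [MeasurableSpace Ω'] [MeasurableSpace Ω''] {P' : Measure Ω'} [IsProbabilityMeasure P'] {P'' : Measure Ω''}
    [IsProbabilityMeasure P''] {F : ℕ → Ω → ℝ} {Z : Ω' → ℝ} {W : Ω'' → ℝ}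
    (h : TendstoInDistribution F atTop Z (fun _ => P) P') (hW : AEMeasurable W P'')
    (hZW : P'.map Z = P''.map W) : TendstoInDistribution F atTop W (fun _ => P) P'' := by
  refine ⟨h.forall_aemeasurable, hW, ?_⟩
  have := h.tendsto
  simpa only [hZW] using this

theorem aemeasurable_thetaHat {X : ℕ → Ω → ℝ} (hX : ∀ n, AEMeasurable (X n) P) (n : ℕ) :
    AEMeasurable (fun ω => thetaHat (fun k => X k ω) n) P :=
  (Finset.aemeasurable_fun_sum _ fun k _ => (hX (k + 1)).mul (hX k)).div
    (Finset.aemeasurable_fun_sum _ fun k _ => (hX k).pow_const 2)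

theorem aemeasurable_lsResidual {X : ℕ → Ω → ℝ} (hX : ∀ n, AEMeasurable (X n) P) (n k : ℕ) :
    AEMeasurable (fun ω => lsResidual (fun k => X k ω) n k) P := by
  cases k with
  | zero => exact hX 0
  | succ k => exact (hX (k + 1)).sub ((aemeasurable_thetaHat hX n).mul (hX k))

theorem aemeasurable_dwRoot {X : ℕ → Ω → ℝ} (hX : ∀ n, AEMeasurable (X n) P) (n : ℕ) :
    AEMeasurable (fun ω => dwRoot (fun k => X k ω) n) P := by
  have h1 := aemeasurable_lsResidual hX n
  have h2 : AEMeasurable (fun ω => durbinWatson (fun k => X k ω) n) P :=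
    (Finset.aemeasurable_fun_sum _ fun k _ => ((h1 (k + 1)).sub (h1 k)).pow_const 2).div
      (Finset.aemeasurable_fun_sum _ fun k _ => (h1 k).pow_const 2)
  exact ((h2.sub_const 2).div ((aemeasurable_thetaHat hX n).const_mul 2)).const_mul _

theorem aemeasurable_residualPrecision {X : ℕ → Ω → ℝ} (hX : ∀ n, AEMeasurable (X n) P) (n : ℕ) :
    AEMeasurable (fun ω => residualPrecision (fun k => X k ω) n) P :=
  (Finset.aemeasurable_fun_sum _ fun k _ =>
    (aemeasurable_lsResidual hX n k).pow_const 2).const_div _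

theorem aemeasurable_lagError {θ : ℝ} {X : ℕ → Ω → ℝ} (hX : ∀ n, AEMeasurable (X n) P) (n : ℕ) :
    AEMeasurable (fun ω => lagError θ (fun k => X k ω) n) P :=
  ((Finset.aemeasurable_fun_sum _ fun k _ => (hX (k + 1)).mul (hX k)).div
    (Finset.aemeasurable_fun_sum _ fun k _ => (hX k).pow_const 2)).const_sub _

/-- The filtration generated by a sequence of random variables; at time `k` the first `k` of them
are known. -/
def pastFiltration {ξ : ℕ → Ω → ℝ} (hξ : ∀ k, Measurable (ξ k)) :
    Filtration ℕ (inferInstance : MeasurableSpace Ω) where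
  seq k := ⨆ j ∈ Set.Iio k, MeasurableSpace.comap (ξ j) inferInstance
  mono' _ _ h := biSup_mono fun _ hj => lt_of_lt_of_le hj h
  le' _ := iSup₂_le fun j _ => (hξ j).comap_le

theorem measurable_pastFiltration {ξ : ℕ → Ω → ℝ} (hξ : ∀ k, Measurable (ξ k)) (k : ℕ) :
    Measurable[pastFiltration hξ (k + 1)] (ξ k) :=
  Measurable.of_comap_le (le_iSup₂_of_le (f := fun j (_ : j ∈ Set.Iio (k + 1)) =>
    MeasurableSpace.comap (ξ j) inferInstance) k (Nat.lt_succ_self k) le_rfl)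

theorem indep_pastFiltration {ξ : ℕ → Ω → ℝ} (hξ : ∀ k, Measurable (ξ k)) (hindep : iIndepFun ξ P)
    (k : ℕ) : Indep (MeasurableSpace.comap (ξ k) inferInstance) (pastFiltration hξ k) P := by
  have h := indep_iSup_of_disjoint (fun j => (hξ j).comap_le) hindep.iIndep
    (S := {k}) (T := Set.Iio k) (by simp)
  rw [iSup_singleton] at h
  exact h

theorem measurable_autoregression {ξ : ℕ → Ω → ℝ} (hξ : ∀ k, Measurable (ξ k)) (θ : ℝ) (k : ℕ) :
    Measurable[pastFiltration hξ k] fun ω => autoregression θ (fun n => ξ n ω) k := by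
  induction k with
  | zero => exact measurable_const
  | succ k ih =>
    exact ((ih.mono ((pastFiltration hξ).mono (Nat.le_succ k)) le_rfl).const_mul θ).add
      (measurable_pastFiltration hξ k)

theorem measurable_lagWeight {ξ : ℕ → Ω → ℝ} (hξ : ∀ k, Measurable (ξ k)) (θ : ℝ) (k : ℕ) :
    Measurable[pastFiltration hξ k]
      fun ω => lagWeight θ (autoregression θ fun n => ξ n ω) k := by
  cases k with
  | zero => exact measurable_const
  | succ k =>
    exact ((measurable_autoregression hξ θ k).mono
      ((pastFiltration hξ).mono (Nat.le_succ k)) le_rfl).sub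
      ((measurable_autoregression hξ θ (k + 1)).const_mul θ)

/-- Under the null hypothesis, the signed root of the test statistic is asymptotically standard
Gaussian. The limit is written as a multiple of a Gaussian variable with variance `σ ^ 4`. -/
theorem tendstoInDistribution_dwRoot [IsProbabilityMeasure P] {θ σ : ℝ}
    (hθ : |θ| < 1) (hσ : 0 < σ) (hθ0 : θ ≠ 0)
    {V X : ℕ → Ω → ℝ} (hV_indep : iIndepFun (fun n => V (n + 1)) P)
    (hV_ident : ∀ n, IdentDistrib (V (n + 1)) (V 1) P P)
    (hV_mean : ∫ ω, V 1 ω ∂P = 0) (hV_var : variance (V 1) P = σ ^ 2)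
    (hV_four : MemLp (V 1) 4 P) (hX_meas : ∀ n, AEMeasurable (X n) P)
    (hX : ∀ n ω, X (n + 1) ω = θ * X n ω + V (n + 1) ω) :
    TendstoInDistribution (fun (n : ℕ) ω => dwRoot (fun k => X k ω) n) atTop
      (fun z : ℝ => z * (σ ^ 2)⁻¹) (fun _ => P) (gaussianReal 0 (σ ^ 2 * σ ^ 2).toNNReal) := by
  have hVm : ∀ n, AEMeasurable (V (n + 1)) P := fun n => (hV_ident n).aemeasurable_fst
  -- measurable versions of the noise
  set ξ : ℕ → Ω → ℝ := fun n => (hVm n).mk (V (n + 1))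
  have hξ : ∀ n, Measurable (ξ n) := fun n => (hVm n).measurable_mk
  have hξV : ∀ n, V (n + 1) =ᵐ[P] ξ n := fun n => (hVm n).ae_eq_mk
  have hξV' : ∀ᵐ ω ∂P, ∀ n, V (n + 1) ω = ξ n ω := ae_all_iff.2 hξV
  set μ := P.map (V 1) with hμ
  have hμP : IsProbabilityMeasure μ := Measure.isProbabilityMeasure_map (hVm 0)
  have hlaw : ∀ n, P.map (ξ n) = μ := fun n => by
    rw [← Measure.map_congr (hξV n), (hV_ident n).map_eq]
  have hint : MemLp id 2 μ := by
    rw [hμ, memLp_map_measure_iff aestronglyMeasurable_id (hVm 0)]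
    exact hV_four.mono_exponent (by norm_num)
  have hmean : ∫ x, x ∂μ = 0 := by
    rw [hμ, ← hV_mean]
    exact integral_map (hVm 0) aestronglyMeasurable_id
  have hvar : ∫ x, x ^ 2 ∂μ = σ ^ 2 := by
    rw [hμ, integral_map (hVm 0) (by fun_prop), ← hV_var,
      variance_of_integral_eq_zero (hVm 0) hV_mean]
  have hind := hV_indep.congr hξV
  have hpath := ae_isNoisePath hV_indep hV_ident hV_mean hV_var hV_four
  set Y : Ω → ℕ → ℝ := fun ω => autoregression θ fun n => ξ n ω
  have hY : ∀ᵐ ω ∂P, ∀ n, Y ω (n + 1) = θ * Y ω n + V (n + 1) ω := by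
    filter_upwards [hξV'] with ω h n
    rw [h n]
    rfl
  have hY0 : ∀ ω, Y ω 0 = 0 := fun ω => rfl
  -- the leading martingale transform
  have hZ := tendstoInDistribution_martingaleTransform (P := P) (l := σ ^ 2)
    (measurable_pastFiltration hξ) hlaw (indep_pastFiltration hξ hind) hint hmean hvar
    (measurable_lagWeight hξ θ) (by
      filter_upwards [hpath, hY] with ω h1 h2
      exact h1.tendsto_avg_lagWeight_sq hθ h2)
  -- the least squares martingale
  have hQ := tendstoInDistribution_martingaleTransform (P := P) (l := arVariance θ 0 σ)
    (measurable_pastFiltration hξ) hlaw (indep_pastFiltration hξ hind) hint hmean hvar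
    (measurable_autoregression hξ θ) (by
      filter_upwards [hpath, hY] with ω h1 h2
      exact (h1.tendsto_avg_sq_and_mul hθ (by simp) (x := Y ω) (e := fun n => V n ω) h2
        (eq_zero_mul_add fun n => V n ω)).1)
  have ha : TendstoInMeasure P (fun n ω => residualPrecision (fun k => X k ω) n) atTop
      fun _ => (σ ^ 2)⁻¹ := by
    refine tendstoInMeasure_of_tendsto_ae
      (fun n => (aemeasurable_residualPrecision hX_meas n).aestronglyMeasurable) ?_
    filter_upwards [hpath] with ω h
    exact h.tendsto_residualPrecision hθ hσ (x := fun k => X k ω) (hX · ω)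
  have hc : TendstoInMeasure P (fun n ω => lagError θ (fun k => X k ω) n
      * residualPrecision (fun k => X k ω) n) atTop fun _ => (0 : ℝ) := by
    refine tendstoInMeasure_of_tendsto_ae (fun n => ((aemeasurable_lagError hX_meas n).mul
      (aemeasurable_residualPrecision hX_meas n)).aestronglyMeasurable) ?_
    filter_upwards [hpath] with ω h
    have := (h.tendsto_lagError hθ hσ (x := fun k => X k ω) (hX · ω)).mul
      (h.tendsto_residualPrecision hθ hσ (x := fun k => X k ω) (hX · ω))
    rwa [zero_mul] at this
  have hZa := hZ.continuous_comp_prodMk_of_tendstoInMeasure_const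
    (g := fun p : ℝ × ℝ => p.1 * p.2) (by fun_prop) ha (aemeasurable_residualPrecision hX_meas)
  have hQc := hQ.continuous_comp_prodMk_of_tendstoInMeasure_const
    (g := fun p : ℝ × ℝ => p.1 * p.2) (by fun_prop) hc fun n =>
      (aemeasurable_lagError hX_meas n).mul (aemeasurable_residualPrecision hX_meas n)
  simp only [mul_zero, id] at hQc hZa
  have hQ0 := tendstoInMeasure_of_tendstoInDistribution_zero hQc
  have hsum := hZa.add_of_tendstoInMeasure_const hQ0 hQc.forall_aemeasurable
  simp only [add_zero] at hsum
  refine tendstoInDistribution_of_tendstoInMeasure_sub _ _ hsum ?_ (aemeasurable_dwRoot hX_meas)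
  refine tendstoInMeasure_of_tendsto_ae (fun n =>
    ((aemeasurable_dwRoot hX_meas n).sub (hsum.forall_aemeasurable n)).aestronglyMeasurable) ?_
  filter_upwards [hpath, hY, hξV'] with ω h1 h2 h3
  refine (h1.tendsto_dwRoot_sub hθ hσ hθ0 (x := fun k => X k ω) (hX · ω) h2 (hY0 ω)).congr
    fun n => ?_
  simp only [h3]
  exact sub_sub _ _ _

end Distribution

theorem gaussianReal_map_sq_eq_chiSquareOne {σ : ℝ} (hσ : 0 < σ) :
    (gaussianReal 0 (σ ^ 2 * σ ^ 2).toNNReal).map (fun z : ℝ => (z * (σ ^ 2)⁻¹) ^ 2)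
      = chiSquareOne := by
  have h1 : (gaussianReal 0 (σ ^ 2 * σ ^ 2).toNNReal).map (fun z : ℝ => z * (σ ^ 2)⁻¹)
      = gaussianReal 0 1 := by
    rw [gaussianReal_map_mul_const, mul_zero]
    congr 1
    rw [← NNReal.coe_inj]
    push_cast
    rw [Real.coe_toNNReal _ (by positivity)]
    field_simp
  rw [chiSquareOne, ← h1, Measure.map_map (by fun_prop) (by fun_prop)]
  rfl

theorem theorem4p6 {Ω : Type*} [MeasurableSpace Ω] (P : Measure Ω) [IsProbabilityMeasure P]
    (θ ρ σ : ℝ) (hθ : |θ| < 1) (hρ : |ρ| < 1) (hσ : 0 < σ)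
    (V ε X : ℕ → Ω → ℝ)
    -- the noise `V 1, V 2, …` is i.i.d., centred, with variance `σ ^ 2` (`V 0` is not used)
    (hV_indep : iIndepFun (fun n => V (n + 1)) P)
    (hV_ident : ∀ n, IdentDistrib (V (n + 1)) (V 1) P P)
    (hV_mean : ∫ ω, V 1 ω ∂P = 0)
    (hV_var : variance (V 1) P = σ ^ 2)
    -- finite moment of order four
    (hV_four : MemLp (V 1) 4 P)
    -- the initial values are arbitrary random variables
    (hX_zero : AEMeasurable (X 0) P) (hε_zero : AEMeasurable (ε 0) P)
    (hX : ∀ n ω, X (n + 1) ω = θ * X n ω + ε (n + 1) ω)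
    (hε : ∀ n ω, ε (n + 1) ω = ρ * ε n ω + V (n + 1) ω)
    (hθ_ne_zero : θ ≠ 0) (hθ_ne : θ ≠ -ρ) :
    (ρ = 0 →
      TendstoInDistribution (fun (n : ℕ) (ω : Ω) => dwTestStatistic (fun k => X k ω) n) atTop
        (id : ℝ → ℝ) (fun _ => P) chiSquareOne) ∧
    (ρ ≠ 0 →
      ∀ᵐ ω ∂P, Tendsto (fun n : ℕ => dwTestStatistic (fun k => X k ω) n) atTop atTop) := by
  refine ⟨?_, fun hρ0 => ?_⟩
  · rintro rfl
    have hX' : ∀ n ω, X (n + 1) ω = θ * X n ω + V (n + 1) ω := fun n ω => by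
      rw [hX, hε, zero_mul, zero_add]
    have hX_meas : ∀ n, AEMeasurable (X n) P := by
      intro n
      induction n with
      | zero => exact hX_zero
      | succ n ih =>
        rw [show X (n + 1) = fun ω => θ * X n ω + V (n + 1) ω from funext (hX' n)]
        exact (ih.const_mul θ).add (hV_ident n).aemeasurable_fst
    have h := (tendstoInDistribution_dwRoot hθ hσ hθ_ne_zero hV_indep hV_ident hV_mean hV_var
      hV_four hX_meas hX').continuous_comp (g := fun z : ℝ => z ^ 2) (by fun_prop)
    simp only [Function.comp_def, dwRoot_sq] at h
    refine h.of_map_eq aemeasurable_id ?_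
    rw [gaussianReal_map_sq_eq_chiSquareOne hσ, Measure.map_id]
  · filter_upwards [ae_isNoisePath hV_indep hV_ident hV_mean hV_var hV_four] with ω hω
    exact hω.tendsto_dwTestStatistic_atTop hθ hρ hσ hθ_ne_zero hρ0 hθ_ne
      (x := fun k => X k ω) (e := fun k => ε k ω) (hX · ω) (hε · ω)
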